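/- Let $(M^m,g)$ and $(N^n,h)$ be smooth Riemannian manifolds without boundary, of dimensions $m\neq 2$ and $n\geq 1$, and let $K>0$. For a smooth map $\psi:M\to N$ and a compact set $D\subset M$ put $$\mathcal E_{\sigma_1}(\psi;g,D)=\tfrac12\int_D|\mathrm d\psi|^2\,\nu_g,\qquad \mathcal E_{\sigma_2}(\psi;g,D)=\tfrac12\int_D|\wedge^2\mathrm d\psi|^2\,\nu_g,\qquad \mathcal E_{\sigma_{1,2}}=\mathcal E_{\sigma_1}+K\,\mathcal E_{\sigma_2},$$ where the norms are taken with respect to $g$ and $h$ and $\nu_g$ is the Riemannian measure of $g$. A smooth map $\varphi:M\to N$ is called a critical point of one of these energies if for every compact $D\subset M$ and every smooth variation $(\varphi_t)_{|t|<\varepsilon}$ of $\varphi=\varphi_0$ with $\varphi_t=\varphi$ outside $D$ the energy of $\varphi_t$ over $D$ has derivative $0$ at $t=0$. The map $\varphi$ is harmonic with respect to $g$ if it is critical for $\mathcal E_{\sigma_1}$, $\sigma_2$-critical if it is critical for $\mathcal E_{\sigma_2}$, and $\sigma_{1,2}$-critical if it is critical for $\mathcal E_{\sigma_{1,2}}$.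 Let $\varphi:(M,g)\to(N,h)$ be horizontally conformal with dilation $\lambda:M\to\mathbb R\setminus\{0\}$, that is, $\varphi$ is smooth and at every $x\in M$ the differential $\mathrm d\varphi_x$ is surjective and satisfies $h(\mathrm d\varphi_x v,\mathrm d\varphi_x w)=\lambda(x)^2 g(v,w)$ for all $v,w\in(\ker \mathrm d\varphi_x)^\perp$. Then: 1. $\widetilde g=\left[1+K(n-1)\lambda^2\right]^{\frac{2}{m-2}}g$ is a smooth Riemannian metric on $M$, and $\varphi$ is $\sigma_{1,2}$-critical (with respect to $g$ and $h$) if and only if $\varphi:(M,\widetilde g)\to(N,h)$ is harmonic. 2. If $n\geq 2$, then $\widetilde g=|\lambda|^{\frac{4}{m-2}}g$ is a smooth Riemannian metric on $M$, and $\varphi$ is $\sigma_2$-critical (with respect to $g$ and $h$) if and only if $\varphi:(M,\widetilde g)\to(N,h)$ is harmonic. -/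

import Mathlib

open Set Function MeasureTheory Manifold Bundle
open scoped ContDiff Topology

noncomputable section

/-- A real vector space of dimension `m` with an inner product has an orthonormal basis. -/
theorem exists_orthonormal_basis_of_core {V : Type*} [AddCommGroup V] [Module ℝ V]
    [FiniteDimensional ℝ V] {m : ℕ} (hV : Module.finrank ℝ V = m)
    (c : InnerProductSpace.Core ℝ V) :
    ∃ b : Module.Basis (Fin m) ℝ V, ∀ i j, c.inner (b i) (b j) = if i = j then 1 else 0 := by
  let _ : NormedAddCommGroup V := c.toNormedAddCommGroup
  let _ : InnerProductSpace ℝ V := InnerProductSpace.ofCore c.toCore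
  let e : OrthonormalBasis (Fin m) ℝ V := (stdOrthonormalBasis ℝ V).reindex (finCongr hV)
  refine ⟨e.toBasis, fun i j => ?_⟩
  have h := orthonormal_iff_ite.mp e.orthonormal i j
  simpa using h

section Riemannian

variable {m : ℕ} {M : Type*} [TopologicalSpace M] [ChartedSpace (EuclideanSpace ℝ (Fin m)) M]
  [IsManifold (𝓡 m) ∞ M]

variable (m M) in
/-- Smooth Riemannian metrics on the `m`-dimensional smooth manifold `M`. -/
abbrev SmoothMetric : Type _ :=
  ContMDiffRiemannianMetric (𝓡 m) ∞ (EuclideanSpace ℝ (Fin m))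
    (fun x : M => TangentSpace (𝓡 m) x)

/-- `g' = f • g` for the positive function `f`. -/
def IsConformalChange (f : M → ℝ) (g g' : SmoothMetric m M) : Prop :=
  ∀ x : M, 0 < f x ∧ ∀ v w : TangentSpace (𝓡 m) x, g'.inner x v w = f x * g.inner x v w

theorem exists_orthonormalFrame (g : SmoothMetric m M) (x : M) :
    ∃ b : Module.Basis (Fin m) ℝ (TangentSpace (𝓡 m) x),
      ∀ i j, g.inner x (b i) (b j) = if i = j then 1 else 0 := by
  have : FiniteDimensional ℝ (TangentSpace (𝓡 m) x) :=
    inferInstanceAs (FiniteDimensional ℝ (EuclideanSpace ℝ (Fin m)))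
  have h : Module.finrank ℝ (TangentSpace (𝓡 m) x) = m :=
    finrank_euclideanSpace_fin (𝕜 := ℝ) (n := m)
  exact exists_orthonormal_basis_of_core h (g.toRiemannianMetric.toCore x)

/-- A `g`-orthonormal basis of the tangent space at `x`. -/
def orthonormalFrame (g : SmoothMetric m M) (x : M) :
    Module.Basis (Fin m) ℝ (TangentSpace (𝓡 m) x) :=
  (exists_orthonormalFrame g x).choose

/-- The Gram matrix `g(∂ᵢ, ∂ⱼ)` of the coordinate vector fields of the chart around `p`, at the
point with coordinates `y` (meaningful for `y` in the range of the chart). -/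
def gramMatrix (g : SmoothMetric m M) (p : M) (y : EuclideanSpace ℝ (Fin m)) :
    Matrix (Fin m) (Fin m) ℝ :=
  Matrix.of fun i j =>
    g.inner ((extChartAt (𝓡 m) p).symm y)
      (mfderivWithin 𝓘(ℝ, EuclideanSpace ℝ (Fin m)) (𝓡 m) (extChartAt (𝓡 m) p).symm (range (𝓡 m)) y
        (EuclideanSpace.single i (1 : ℝ)))
      (mfderivWithin 𝓘(ℝ, EuclideanSpace ℝ (Fin m)) (𝓡 m) (extChartAt (𝓡 m) p).symm (range (𝓡 m)) y
        (EuclideanSpace.single j (1 : ℝ)))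

section Volume

variable [T2Space M] [SigmaCompactSpace M]

variable (m M) in
/-- A smooth partition of unity subordinate to the cover of `M` by its preferred chart domains. -/
def chartPartition : SmoothPartitionOfUnity M (𝓡 m) M univ :=
  (SmoothPartitionOfUnity.exists_isSubordinate_chartAt_source (𝓡 m) M).choose

variable (m M) in
theorem chartPartition_isSubordinate :
    (chartPartition m M).IsSubordinate
      (fun p : M => (chartAt (EuclideanSpace ℝ (Fin m)) p).source) :=
  (SmoothPartitionOfUnity.exists_isSubordinate_chartAt_source (𝓡 m) M).choose_spec

/-- The Riemannian measure `ν_g`: it is `√(det g_ij) dx¹ ⋯ dxᵐ` in every chart, and the charts are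
put together by a partition of unity `ρ`, so that
`∫ f dν_g = ∑ₚ ∫ (ρₚ f √(det g_ij)) dx¹ ⋯ dxᵐ`, the `p`-th integral being taken in the chart
around `p`. -/
def riemannianMeasure [MeasurableSpace M] [BorelSpace M] (g : SmoothMetric m M) : Measure M :=
  Measure.sum fun p : M =>
    (((volume : Measure (EuclideanSpace ℝ (Fin m))).restrict
      (extChartAt (𝓡 m) p).target).withDensity
        (fun y => ENNReal.ofReal
          (chartPartition m M p ((extChartAt (𝓡 m) p).symm y) *
            Real.sqrt (gramMatrix g p y).det))).map
      (extChartAt (𝓡 m) p).symm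

end Volume

variable {n : ℕ} {N : Type*} [TopologicalSpace N] [ChartedSpace (EuclideanSpace ℝ (Fin n)) N]
  [IsManifold (𝓡 n) ∞ N]

/-- `φ` is horizontally conformal with dilation `lam`: at every point, its differential is onto and
multiplies the inner product of horizontal vectors by `lam²`, where `lam ≠ 0`. A vector is
horizontal if it is orthogonal to the kernel of the differential. -/
structure IsHorizontallyConformal (g : SmoothMetric m M) (h : SmoothMetric n N) (φ : M → N)
    (lam : M → ℝ) : Prop where
  smooth : ContMDiff (𝓡 m) (𝓡 n) ∞ φ
  dilation_ne_zero : ∀ x, lam x ≠ 0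
  surjective : ∀ x, Surjective (mfderiv (𝓡 m) (𝓡 n) φ x)
  conformal : ∀ x, ∀ v w : TangentSpace (𝓡 m) x,
    (∀ u, mfderiv (𝓡 m) (𝓡 n) φ x u = 0 → g.inner x u v = 0) →
    (∀ u, mfderiv (𝓡 m) (𝓡 n) φ x u = 0 → g.inner x u w = 0) →
    h.inner (φ x) (mfderiv (𝓡 m) (𝓡 n) φ x v) (mfderiv (𝓡 m) (𝓡 n) φ x w) =
      lam x ^ 2 * g.inner x v w

/-- The pulled back form `(φ^* h)_x (v, w) = h (dφ v, dφ w)`. -/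
def pullbackForm (h : SmoothMetric n N) (φ : M → N) (x : M) (v w : TangentSpace (𝓡 m) x) : ℝ :=
  h.inner (φ x) (mfderiv (𝓡 m) (𝓡 n) φ x v) (mfderiv (𝓡 m) (𝓡 n) φ x w)

/-- `|dφ|² = ∑ᵢ |dφ(eᵢ)|²` for a `g`-orthonormal basis `e`. -/
def normSqDifferential (g : SmoothMetric m M) (h : SmoothMetric n N) (φ : M → N) (x : M) : ℝ :=
  ∑ i, pullbackForm h φ x (orthonormalFrame g x i) (orthonormalFrame g x i)

/-- `|Λ²dφ|² = ∑_{i < j} |dφ(eᵢ) ∧ dφ(eⱼ)|²` for a `g`-orthonormal basis `e`, where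
`|a ∧ b|² = |a|² |b|² - ⟨a, b⟩²`. -/
def normSqWedgeDifferential (g : SmoothMetric m M) (h : SmoothMetric n N) (φ : M → N) (x : M) :
    ℝ :=
  ∑ i, ∑ j ∈ Finset.Ioi i,
    (pullbackForm h φ x (orthonormalFrame g x i) (orthonormalFrame g x i) *
        pullbackForm h φ x (orthonormalFrame g x j) (orthonormalFrame g x j) -
      pullbackForm h φ x (orthonormalFrame g x i) (orthonormalFrame g x j) ^ 2)

/-- `φ` is a critical point of the functional `E`, where `E ψ D` is the energy of `ψ` over the
compact set `D`: `φ` is smooth, and for every compact `D` and every smooth variation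
`Φ : (-ε, ε) × M → N` of `φ` that is constant in time outside `D`,
the derivative of `t ↦ E (Φ t) D` at `0` exists and vanishes. -/
def IsCriticalPoint (m n : ℕ) {M : Type*} [TopologicalSpace M]
    [ChartedSpace (EuclideanSpace ℝ (Fin m)) M]
    {N : Type*} [TopologicalSpace N] [ChartedSpace (EuclideanSpace ℝ (Fin n)) N]
    (E : (M → N) → Set M → ℝ) (φ : M → N) : Prop :=
  ContMDiff (𝓡 m) (𝓡 n) ∞ φ ∧
    ∀ (D : Set M) (ε : ℝ) (Φ : ℝ → M → N), IsCompact D → 0 < ε →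
      ContMDiffOn (𝓘(ℝ, ℝ).prod (𝓡 m)) (𝓡 n) ∞ (uncurry Φ) (Ioo (-ε) ε ×ˢ univ) →
      Φ 0 = φ →
      (∀ t ∈ Ioo (-ε) ε, ∀ x ∉ D, Φ t x = φ x) →
      HasDerivAt (fun t => E (Φ t) D) 0 0

variable [T2Space M] [SigmaCompactSpace M] [MeasurableSpace M] [BorelSpace M]

/-- The Dirichlet energy `½ ∫_D |dφ|² ν_g`. -/
def sigma1Energy (g : SmoothMetric m M) (h : SmoothMetric n N) (φ : M → N) (D : Set M) : ℝ :=
  1 / 2 * ∫ x in D, normSqDifferential g h φ x ∂(riemannianMeasure g)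

/-- The `σ₂`-energy `½ ∫_D |Λ²dφ|² ν_g`. -/
def sigma2Energy (g : SmoothMetric m M) (h : SmoothMetric n N) (φ : M → N) (D : Set M) : ℝ :=
  1 / 2 * ∫ x in D, normSqWedgeDifferential g h φ x ∂(riemannianMeasure g)

/-- The `σ₁,₂`-energy with coupling constant `K`. -/
def sigma12Energy (g : SmoothMetric m M) (h : SmoothMetric n N) (K : ℝ) (φ : M → N)
    (D : Set M) : ℝ :=
  sigma1Energy g h φ D + K * sigma2Energy g h φ D

/-- Harmonic maps are the critical points of the Dirichlet energy. -/
def IsHarmonicMap (g : SmoothMetric m M) (h : SmoothMetric n N) (φ : M → N) : Prop :=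
  IsCriticalPoint m n (sigma1Energy g h) φ

def IsSigma2Critical (g : SmoothMetric m M) (h : SmoothMetric n N) (φ : M → N) : Prop :=
  IsCriticalPoint m n (sigma2Energy g h) φ

def IsSigma12Critical (g : SmoothMetric m M) (h : SmoothMetric n N) (K : ℝ) (φ : M → N) : Prop :=
  IsCriticalPoint m n (sigma12Energy g h K) φ

end Riemannian

end

/-! No Euler–Lagrange equation is needed: for every single variation of `φ`, the two first
variations agree up to a nonzero constant. Let `A t` be the matrix of the pullback of `h` by `Φ t`
in a `g`-orthonormal frame at a fixed point. Then `|dΦ|² = tr A` and `|Λ²dΦ|² = ½((tr A)² - tr A²)`.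
Horizontal conformality of `φ` gives `A 0 * A 0 = λ² A 0` and `tr (A 0) = n λ²`. Each `A t` is
positive semidefinite, so for `v` in the kernel of `A 0` the function `v·(A t)v` is minimal at `t =
0`; hence `A'(0)` has no component on that kernel and `tr (A 0 A') = λ² tr A'`
(`trace_mul_deriv_of_posSemidef`). The derivative of `|Λ²dΦ|²` at `0` is therefore `(n - 1) λ²`
times that of `|dΦ|²` (`hasDerivAt_normSqWedgeDifferential`). The first variations of the two
energies at `φ` are thus those of a Dirichlet energy with weight `u = 1 + K(n-1)λ²`, respectively `n
- 1` times one with weight `u = λ²`. A conformal factor `f` multiplies the measure by `f^(m/2)` and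
`|dψ|²` by `f⁻¹`, so `f = u^(2/(m-2))` produces exactly the weight `u`
(`sigma1Energy_of_isConformalChange`). The analytic work is differentiation under the integral: the
densities are smooth in time and space jointly, and the Riemannian measure is finite on compact
sets. -/

/-! ### Linear algebra: principal minors and traces under change of basis. -/

/-- The summand is symmetric in `i, j` and vanishes on the diagonal, so the sum over all pairs,
which is `(tr A)² - tr A²`, counts each pair `i < j` twice. -/
theorem sum_Ioi_minors_eq {m : ℕ} (A : Matrix (Fin m) (Fin m) ℝ) (hA : A.IsSymm) :
    ∑ i, ∑ j ∈ Finset.Ioi i, (A i i * A j j - A i j ^ 2) =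
      1 / 2 * (A.trace ^ 2 - (A * A).trace) := by
  have hs : ∀ i j, A j i = A i j := fun i j => hA.apply i j
  have hall : A.trace ^ 2 - (A * A).trace = ∑ i, ∑ j, (A i i * A j j - A i j ^ 2) := by
    simp only [Matrix.trace, Matrix.diag_apply, Matrix.mul_apply, sq, Finset.sum_mul_sum,
      Finset.sum_sub_distrib, hs]
  have hsplit : ∀ i, ∑ j, (A i i * A j j - A i j ^ 2) =
      ∑ j ∈ Finset.Ioi i, (A i i * A j j - A i j ^ 2) +
        ∑ j ∈ Finset.Iio i, (A i i * A j j - A i j ^ 2) := by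
    intro i
    rw [← Finset.sum_filter_add_sum_filter_not Finset.univ (fun j => i < j)]
    congr 1
    · exact Finset.sum_congr (by ext; simp) fun _ _ => rfl
    · symm
      refine Finset.sum_subset (fun j hj => ?_) fun j hj hj' => ?_
      · simpa using (Finset.mem_Iio.mp hj).le
      · have : j = i := le_antisymm (by simpa using hj) (by simpa using hj')
        subst this; ring
  have hswap : ∑ i, ∑ j ∈ Finset.Iio i, (A i i * A j j - A i j ^ 2) =
      ∑ i, ∑ j ∈ Finset.Ioi i, (A i i * A j j - A i j ^ 2) := by
    rw [Finset.sum_comm' (t' := Finset.univ) (s' := fun j => Finset.Ioi j) (by simp)]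
    exact Finset.sum_congr rfl fun i _ => Finset.sum_congr rfl fun j _ => by rw [hs i j]; ring
  rw [hall, Finset.sum_congr rfl fun i _ => hsplit i, Finset.sum_add_distrib, hswap]
  ring

section BasisChange

variable {m : ℕ} {V : Type*} [AddCommGroup V] [Module ℝ V]

/-- With `P = e.toMatrix b`, the Gram matrix of `b` is `PᵀP` and the form becomes `PᵀAP`, so the
quotient is `P⁻¹AP`. Traces computed in an arbitrarily chosen orthonormal frame can thus be read off
from a coordinate basis, which varies smoothly. -/
theorem gram_inv_mul_conj (e b : Module.Basis (Fin m) ℝ V) (g A : LinearMap.BilinForm ℝ V)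
    (he : LinearMap.BilinForm.toMatrix e g = 1) :
    (LinearMap.BilinForm.toMatrix b g)⁻¹ * LinearMap.BilinForm.toMatrix b A =
      (b.toMatrix e) * LinearMap.BilinForm.toMatrix e A * (e.toMatrix b) := by
  have h1 : e.toMatrix b * b.toMatrix e = 1 := e.toMatrix_mul_toMatrix_flip b
  have h2 : b.toMatrix e * e.toMatrix b = 1 := b.toMatrix_mul_toMatrix_flip e
  have hg : LinearMap.BilinForm.toMatrix b g = (e.toMatrix b).transpose * e.toMatrix b := by
    rw [← LinearMap.BilinForm.toMatrix_mul_basis_toMatrix e b g, he, Matrix.mul_one]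
  have hA : LinearMap.BilinForm.toMatrix b A =
      (e.toMatrix b).transpose * LinearMap.BilinForm.toMatrix e A * e.toMatrix b :=
    (LinearMap.BilinForm.toMatrix_mul_basis_toMatrix e b A).symm
  have hinv : (LinearMap.BilinForm.toMatrix b g)⁻¹ = b.toMatrix e * (b.toMatrix e).transpose := by
    refine Matrix.inv_eq_left_inv ?_
    rw [hg, Matrix.mul_assoc, ← Matrix.mul_assoc (b.toMatrix e).transpose,
      ← Matrix.transpose_mul, h1, Matrix.transpose_one, Matrix.one_mul, h2]
  rw [hinv, hA, Matrix.mul_assoc, ← Matrix.mul_assoc (b.toMatrix e).transpose,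
    ← Matrix.mul_assoc (b.toMatrix e).transpose,
    ← Matrix.transpose_mul, h1, Matrix.transpose_one, Matrix.one_mul, Matrix.mul_assoc]

theorem trace_gram_inv_mul (e b : Module.Basis (Fin m) ℝ V) (g A : LinearMap.BilinForm ℝ V)
    (he : LinearMap.BilinForm.toMatrix e g = 1) :
    ((LinearMap.BilinForm.toMatrix b g)⁻¹ * LinearMap.BilinForm.toMatrix b A).trace =
      (LinearMap.BilinForm.toMatrix e A).trace := by
  rw [gram_inv_mul_conj e b g A he, Matrix.trace_mul_comm, ← Matrix.mul_assoc,
    e.toMatrix_mul_toMatrix_flip b, Matrix.one_mul]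

theorem trace_sq_gram_inv_mul (e b : Module.Basis (Fin m) ℝ V) (g A : LinearMap.BilinForm ℝ V)
    (he : LinearMap.BilinForm.toMatrix e g = 1) :
    ((LinearMap.BilinForm.toMatrix b g)⁻¹ * LinearMap.BilinForm.toMatrix b A *
      ((LinearMap.BilinForm.toMatrix b g)⁻¹ * LinearMap.BilinForm.toMatrix b A)).trace =
      (LinearMap.BilinForm.toMatrix e A * LinearMap.BilinForm.toMatrix e A).trace := by
  have h1 : e.toMatrix b * b.toMatrix e = 1 := e.toMatrix_mul_toMatrix_flip b
  rw [gram_inv_mul_conj e b g A he, Matrix.mul_assoc, Matrix.mul_assoc, Matrix.trace_mul_comm]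
  simp only [Matrix.mul_assoc]
  rw [h1, Matrix.mul_one, ← Matrix.mul_assoc (e.toMatrix b), h1, Matrix.one_mul]

end BasisChange

/-! ### First variation of the sum of minors of a positive semidefinite family. -/

section FirstVariation

variable {m : ℕ}

open Matrix in
theorem trace_mul_deriv_of_posSemidef {μ : ℝ} (hμ : μ ≠ 0)
    {A : ℝ → Matrix (Fin m) (Fin m) ℝ} {A' : Matrix (Fin m) (Fin m) ℝ}
    (hder : ∀ i j, HasDerivAt (fun t => A t i j) (A' i j) 0)
    (hsymm : (A 0).IsSymm) (hpos : ∀ᶠ t in 𝓝 (0 : ℝ), ∀ v, 0 ≤ v ⬝ᵥ (A t *ᵥ v))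
    (hsq : A 0 * A 0 = μ • A 0) : (A 0 * A').trace = μ * A'.trace := by
  -- `R` is `μ` times the projection onto the kernel of `A 0`; the claim is equivalent to `tr (R A')
  -- = 0`.
  set R : Matrix (Fin m) (Fin m) ℝ := μ • 1 - A 0 with hR
  have hRsymm : R.transpose = R := by
    rw [hR, Matrix.transpose_sub, hsymm.eq, Matrix.transpose_smul, Matrix.transpose_one]
  have hAR : A 0 * R = 0 := by
    rw [hR, Matrix.mul_sub, hsq, Matrix.mul_smul, Matrix.mul_one, sub_self]
  have hRR : R * R = μ • R := by
    conv_lhs => rw [hR, Matrix.sub_mul]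
    rw [hAR, sub_zero, Matrix.smul_mul, Matrix.one_mul]
  have hquad : ∀ v : Fin m → ℝ, A 0 *ᵥ v = 0 → v ⬝ᵥ (A' *ᵥ v) = 0 := by
    intro v hv
    have hd : HasDerivAt (fun t => v ⬝ᵥ (A t *ᵥ v)) (v ⬝ᵥ (A' *ᵥ v)) 0 := by
      simp only [dotProduct, mulVec]
      exact HasDerivAt.fun_sum fun i _ => HasDerivAt.const_mul _
        (HasDerivAt.fun_sum fun j _ => (hder i j).mul_const _)
    -- The quadratic form is nonnegative for `t` near `0` and zero at `t = 0`.
    refine IsLocalMin.hasDerivAt_eq_zero ?_ hd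
    filter_upwards [hpos] with t ht
    simpa [hv] using ht v
  -- The columns of `R` lie in the kernel of `A 0`, because `A 0 * R = 0`.
  have hdiag : ∀ i, (R * A' * R) i i = 0 := by
    intro i
    have hv : A 0 *ᵥ (fun k => R k i) = 0 := by
      funext j
      simpa [Matrix.mul_apply, mulVec, dotProduct] using congrFun (congrFun hAR j) i
    have h0 := hquad _ hv
    rw [Matrix.mul_assoc, Matrix.mul_apply]
    rw [← h0, dotProduct]
    refine Finset.sum_congr rfl fun k _ => ?_
    rw [show R i k = R k i from congrFun (congrFun hRsymm k) i |>.symm ▸ rfl]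
    simp [Matrix.mul_apply, mulVec, dotProduct]
  have htr : (R * A').trace = 0 := by
    have h1 : (R * A' * R).trace = 0 := by simp [Matrix.trace, hdiag]
    rw [Matrix.trace_mul_comm, ← Matrix.mul_assoc, hRR, Matrix.smul_mul, Matrix.trace_smul,
      smul_eq_mul] at h1
    exact (mul_eq_zero.mp h1).resolve_left hμ
  rw [hR, Matrix.sub_mul, Matrix.smul_mul, Matrix.one_mul, Matrix.trace_sub, Matrix.trace_smul,
    smul_eq_mul] at htr
  linarith

open Matrix in
-- The derivative is `tr A tr A' - tr (A A')` at `0`; the first term is `c μ tr A'` and the second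
-- is `μ tr A'` by `trace_mul_deriv_of_posSemidef`. In the application `c = n` and `μ = λ²`.
theorem hasDerivAt_sum_minors {μ c : ℝ} (hμ : μ ≠ 0)
    {A : ℝ → Matrix (Fin m) (Fin m) ℝ} {A' : Matrix (Fin m) (Fin m) ℝ}
    (hder : ∀ i j, HasDerivAt (fun t => A t i j) (A' i j) 0)
    (hsymm : (A 0).IsSymm) (hpos : ∀ᶠ t in 𝓝 (0 : ℝ), ∀ v, 0 ≤ v ⬝ᵥ (A t *ᵥ v))
    (hsq : A 0 * A 0 = μ • A 0) (htr : (A 0).trace = c * μ) :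
    HasDerivAt (fun t => 1 / 2 * ((A t).trace ^ 2 - (A t * A t).trace))
      ((c - 1) * μ * A'.trace) 0 := by
  have h1 : HasDerivAt (fun t => (A t).trace) A'.trace 0 := by
    simp only [Matrix.trace, Matrix.diag_apply]
    exact HasDerivAt.fun_sum fun i _ => hder i i
  have h2 : HasDerivAt (fun t => (A t * A t).trace) (A' * A 0 + A 0 * A').trace 0 := by
    simp only [Matrix.trace, Matrix.diag_apply, Matrix.mul_apply, Matrix.add_apply,
      ← Finset.sum_add_distrib]
    exact HasDerivAt.fun_sum fun i _ => HasDerivAt.fun_sum fun j _ => (hder i j).mul (hder j i)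
  refine (((h1.pow 2).sub h2).const_mul (1 / 2)).congr_deriv ?_
  rw [Matrix.trace_add, Matrix.trace_mul_comm A' (A 0),
    trace_mul_deriv_of_posSemidef hμ hder hsymm hpos hsq, htr]
  push_cast
  ring

end FirstVariation

open Matrix in
/-- A surjection `ℓ` with `ℓᵀ` conformal on horizontal vectors satisfies `ℓ ℓᵀ = μ`. -/
theorem mul_transpose_eq_smul_one {m n : ℕ} {μ : ℝ} (l : Matrix (Fin n) (Fin m) ℝ)
    (hsurj : Surjective l.mulVec)
    (hconf : (l * lᵀ)ᵀ * (l * lᵀ) = μ • (l * lᵀ)) : l * lᵀ = μ • 1 := by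
  -- If `l lᵀ x = 0` then `|lᵀ x|² = 0`, so `x` is orthogonal to the range of `l`, which is
  -- everything. Invertibility then permits cancelling `l lᵀ` in `hconf`.
  have hinj : Injective (l * lᵀ).mulVec := by
    rw [← Matrix.coe_mulVecLin, injective_iff_map_eq_zero]
    intro x hx
    have h0 : lᵀ *ᵥ x = 0 := by
      have : (lᵀ *ᵥ x) ⬝ᵥ (lᵀ *ᵥ x) = 0 := by
        have hx' : l *ᵥ (lᵀ *ᵥ x) = 0 := by
          rw [Matrix.mulVec_mulVec]; exact hx
        rw [Matrix.dotProduct_mulVec, Matrix.vecMul_transpose, hx', zero_dotProduct]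
      exact dotProduct_self_eq_zero.mp this
    obtain ⟨y, hy⟩ := hsurj x
    have : x ⬝ᵥ x = 0 := by
      conv_lhs => rw [← hy]
      rw [dotProduct_comm, Matrix.dotProduct_mulVec, ← Matrix.mulVec_transpose, hy, h0,
        zero_dotProduct]
    exact dotProduct_self_eq_zero.mp this
  have hu : IsUnit (l * lᵀ) := Matrix.mulVec_injective_iff_isUnit.mp hinj
  rw [Matrix.transpose_mul, Matrix.transpose_transpose] at hconf
  refine hu.mul_right_cancel ?_
  rw [hconf, Matrix.smul_mul, Matrix.one_mul]

/-! ### The metric and the coordinate basis in a chart. -/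

noncomputable section

set_option linter.unusedSectionVars false
section ChartMetric

variable {m : ℕ} {M : Type*} [TopologicalSpace M] [ChartedSpace (EuclideanSpace ℝ (Fin m)) M]
  [IsManifold (𝓡 m) ∞ M]
/-- The metric read in the chart at `p`, as a bilinear form on the model space. -/
def metricInChart (g : SmoothMetric m M) (p : M) (y : EuclideanSpace ℝ (Fin m)) :
    EuclideanSpace ℝ (Fin m) →L[ℝ] EuclideanSpace ℝ (Fin m) →L[ℝ] ℝ :=
  (trivializationAt (EuclideanSpace ℝ (Fin m) →L[ℝ] EuclideanSpace ℝ (Fin m) →L[ℝ] ℝ)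
    (fun x : M => TangentSpace (𝓡 m) x →L[ℝ] TangentSpace (𝓡 m) x →L[ℝ] ℝ) p
      ⟨(extChartAt (𝓡 m) p).symm y, g.inner _⟩).2

theorem metricInChart_apply (g : SmoothMetric m M) (p : M) {y : EuclideanSpace ℝ (Fin m)}
    (hy : y ∈ (extChartAt (𝓡 m) p).target) (v w : EuclideanSpace ℝ (Fin m)) :
    metricInChart g p y v w = g.inner ((extChartAt (𝓡 m) p).symm y)
      (mfderivWithin 𝓘(ℝ, EuclideanSpace ℝ (Fin m)) (𝓡 m) (extChartAt (𝓡 m) p).symm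
        (range (𝓡 m)) y v)
      (mfderivWithin 𝓘(ℝ, EuclideanSpace ℝ (Fin m)) (𝓡 m) (extChartAt (𝓡 m) p).symm
        (range (𝓡 m)) y w) := by
  have hx : (extChartAt (𝓡 m) p).symm y ∈ (chartAt (EuclideanSpace ℝ (Fin m)) p).source := by
    simpa [extChartAt_source] using (extChartAt (𝓡 m) p).map_target hy
  have : IsManifold (𝓡 m) 1 M := IsManifold.of_le (n := ∞) (by simp)
  have hT := TangentBundle.symmL_trivializationAt (I := 𝓡 m) hx
  rw [(extChartAt (𝓡 m) p).right_inv hy] at hT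
  rw [← hT]
  rw [metricInChart, hom_trivializationAt_apply, ContinuousLinearMap.inCoordinates,
    ContinuousLinearMap.comp_apply, ContinuousLinearMap.comp_apply]
  rw [Trivialization.continuousLinearMapAt_apply, Trivialization.linearMapAt_apply]
  have : (extChartAt (𝓡 m) p).symm y ∈ (trivializationAt (EuclideanSpace ℝ (Fin m) →L[ℝ] ℝ)
      (fun x : M => TangentSpace (𝓡 m) x →L[ℝ] ℝ) p).baseSet := by
    simp [hom_trivializationAt_baseSet]
    simpa using hx
  rw [if_pos this, hom_trivializationAt_apply, ContinuousLinearMap.inCoordinates]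
  simp
  rfl

set_option maxHeartbeats 1000000 in
-- It suffices to test on fixed vectors `v, w`. The trivialization extends them to smooth local
-- vector fields, on which the smooth metric takes smooth values.
theorem contDiffOn_metricInChart (g : SmoothMetric m M) (p : M) :
    ContDiffOn ℝ ∞ (metricInChart g p) (extChartAt (𝓡 m) p).target := by
  simp_rw [contDiffOn_clm_apply]
  intro v w
  rw [← contMDiffOn_iff_contDiffOn]
  let e := trivializationAt (EuclideanSpace ℝ (Fin m)) (TangentSpace (𝓡 m) : M → Type _) p
  have hv (v : EuclideanSpace ℝ (Fin m)) : ContMDiffOn (𝓡 m) ((𝓡 m).prod (𝓡 m)) ∞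
      (fun x => TotalSpace.mk' (EuclideanSpace ℝ (Fin m)) x (e.symmL ℝ x v)) e.baseSet := by
    refine e.contMDiffOn_symmL.clm_bundle_apply (fun x _ => ?_)
    rw [contMDiffWithinAt_section]
    exact contMDiffWithinAt_const
  have h1 := (g.contMDiff.contMDiffOn (s := e.baseSet)).clm_bundle_apply₂ (hv v) (hv w)
  have h2 : ContMDiffOn (𝓡 m) 𝓘(ℝ, ℝ) ∞
      (fun x => g.inner x (e.symmL ℝ x v) (e.symmL ℝ x w)) e.baseSet := by
    intro x hx
    exact contMDiffWithinAt_section.mp (h1 x hx)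
  have hmaps : MapsTo (extChartAt (𝓡 m) p).symm (extChartAt (𝓡 m) p).target e.baseSet := by
    intro y hy
    have := (extChartAt (𝓡 m) p).map_target hy
    simpa [e, extChartAt_source] using this
  refine (h2.comp (contMDiffOn_extChartAt_symm p) hmaps).congr fun y hy => ?_
  have hx : (extChartAt (𝓡 m) p).symm y ∈ (chartAt (EuclideanSpace ℝ (Fin m)) p).source := by
    simpa [extChartAt_source] using (extChartAt (𝓡 m) p).map_target hy
  have : IsManifold (𝓡 m) 1 M := IsManifold.of_le (n := ∞) (by simp)
  have hT := TangentBundle.symmL_trivializationAt (I := 𝓡 m) hx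
  rw [(extChartAt (𝓡 m) p).right_inv hy] at hT
  rw [metricInChart_apply g p hy, ← hT]
  rfl

theorem gramMatrix_eq (g : SmoothMetric m M) (p : M) {y : EuclideanSpace ℝ (Fin m)}
    (hy : y ∈ (extChartAt (𝓡 m) p).target) (i j : Fin m) :
    gramMatrix g p y i j =
      metricInChart g p y (EuclideanSpace.single i 1) (EuclideanSpace.single j 1) :=
  (metricInChart_apply g p hy _ _).symm

theorem contDiffOn_gramMatrix (g : SmoothMetric m M) (p : M) (i j : Fin m) :
    ContDiffOn ℝ ∞ (fun y => gramMatrix g p y i j) (extChartAt (𝓡 m) p).target :=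
  (((contDiffOn_metricInChart g p).clm_apply contDiffOn_const).clm_apply contDiffOn_const).congr
    fun _ hy => gramMatrix_eq g p hy i j

theorem exists_coordBasis (p : M) {y : EuclideanSpace ℝ (Fin m)}
    (hy : y ∈ (extChartAt (𝓡 m) p).target) :
    ∃ b : Module.Basis (Fin m) ℝ (TangentSpace (𝓡 m) ((extChartAt (𝓡 m) p).symm y)),
      ∀ i, b i = mfderivWithin 𝓘(ℝ, EuclideanSpace ℝ (Fin m)) (𝓡 m)
        (extChartAt (𝓡 m) p).symm (range (𝓡 m)) y (EuclideanSpace.single i (1 : ℝ)) := by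
  have : IsManifold (𝓡 m) 1 M := IsManifold.of_le (n := ∞) (by simp)
  obtain ⟨L, hL⟩ := isInvertible_mfderivWithin_extChartAt_symm (I := 𝓡 m) hy
  refine ⟨(EuclideanSpace.basisFun (Fin m) ℝ).toBasis.map L.toLinearEquiv, fun i => ?_⟩
  rw [← hL]
  have h := Module.Basis.map_apply (EuclideanSpace.basisFun (Fin m) ℝ).toBasis L.toLinearEquiv i
  rw [OrthonormalBasis.coe_toBasis, EuclideanSpace.basisFun_apply] at h
  exact h

/-- The basis of the tangent space formed by the coordinate vector fields of the chart. -/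
def coordBasis (p : M) {y : EuclideanSpace ℝ (Fin m)} (hy : y ∈ (extChartAt (𝓡 m) p).target) :
    Module.Basis (Fin m) ℝ (TangentSpace (𝓡 m) ((extChartAt (𝓡 m) p).symm y)) :=
  (exists_coordBasis p hy).choose

theorem coordBasis_apply (p : M) {y : EuclideanSpace ℝ (Fin m)}
    (hy : y ∈ (extChartAt (𝓡 m) p).target) (i : Fin m) :
    coordBasis p hy i = mfderivWithin 𝓘(ℝ, EuclideanSpace ℝ (Fin m)) (𝓡 m)
      (extChartAt (𝓡 m) p).symm (range (𝓡 m)) y (EuclideanSpace.single i (1 : ℝ)) :=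
  (exists_coordBasis p hy).choose_spec i

end ChartMetric

end

/-! ### Energy densities as traces, in orthonormal frames and in coordinates. -/

noncomputable section

set_option linter.unusedSectionVars false

section MatrixSmooth

variable {E : Type*} [NormedAddCommGroup E] [NormedSpace ℝ E] {m : ℕ}

theorem ContDiffAt.matrix_det {k : ℕ∞ω} {G : E → Matrix (Fin m) (Fin m) ℝ} {x : E}
    (hG : ∀ i j, ContDiffAt ℝ k (fun z => G z i j) x) :
    ContDiffAt ℝ k (fun z => (G z).det) x := by
  simp only [Matrix.det_apply]
  exact ContDiffAt.sum fun σ _ => (contDiffAt_prod fun i _ => hG _ _).const_smul _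

/-- Cramer's rule: each entry of the inverse is a determinant divided by `det G`. -/
theorem ContDiffAt.matrix_inv {k : ℕ∞ω} {G : E → Matrix (Fin m) (Fin m) ℝ} {x : E}
    (hG : ∀ i j, ContDiffAt ℝ k (fun z => G z i j) x) (h0 : (G x).det ≠ 0) (i j : Fin m) :
    ContDiffAt ℝ k (fun z => (G z)⁻¹ i j) x := by
  simp only [Matrix.inv_def, Matrix.smul_apply, Ring.inverse_eq_inv', smul_eq_mul,
    Matrix.adjugate_apply]
  refine ((ContDiffAt.matrix_det hG).inv h0).mul (ContDiffAt.matrix_det fun a b => ?_)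
  simp only [Matrix.updateRow_apply]
  split_ifs
  · exact contDiffAt_const
  · exact hG a b

theorem ContDiffAt.matrix_mul {k : ℕ∞ω} {G A : E → Matrix (Fin m) (Fin m) ℝ} {x : E}
    (hG : ∀ i j, ContDiffAt ℝ k (fun z => G z i j) x)
    (hA : ∀ i j, ContDiffAt ℝ k (fun z => A z i j) x) (i j : Fin m) :
    ContDiffAt ℝ k (fun z => (G z * A z) i j) x := by
  simp only [Matrix.mul_apply]
  exact ContDiffAt.sum fun l _ => (hG i l).mul (hA l j)

theorem ContDiffAt.matrix_trace {k : ℕ∞ω} {G : E → Matrix (Fin m) (Fin m) ℝ} {x : E}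
    (hG : ∀ i j, ContDiffAt ℝ k (fun z => G z i j) x) :
    ContDiffAt ℝ k (fun z => (G z).trace) x := by
  simp only [Matrix.trace, Matrix.diag_apply]
  exact ContDiffAt.sum fun l _ => hG l l

end MatrixSmooth

section Forms

variable {m : ℕ} {M : Type*} [TopologicalSpace M] [ChartedSpace (EuclideanSpace ℝ (Fin m)) M]
  [IsManifold (𝓡 m) ∞ M]
  {n : ℕ} {N : Type*} [TopologicalSpace N] [ChartedSpace (EuclideanSpace ℝ (Fin n)) N]
  [IsManifold (𝓡 n) ∞ N]

/-- The Riemannian metric at `x` as a bilinear form. -/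
def metricForm (g : SmoothMetric m M) (x : M) : LinearMap.BilinForm ℝ (TangentSpace (𝓡 m) x) :=
  LinearMap.mk₂ ℝ (fun v w => g.inner x v w) (by simp) (by simp) (by simp) (by simp)

/-- The pulled back form `φ^* h` at `x` as a bilinear form. -/
def pullbackBilinForm (h : SmoothMetric n N) (φ : M → N) (x : M) :
    LinearMap.BilinForm ℝ (TangentSpace (𝓡 m) x) :=
  LinearMap.mk₂ ℝ (pullbackForm h φ x) (by simp [pullbackForm]) (by simp [pullbackForm])
    (by simp [pullbackForm]) (by simp [pullbackForm])

/-- The matrix of `φ^* h` with respect to a `g`-orthonormal frame at `x`. -/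
def framePullback (g : SmoothMetric m M) (h : SmoothMetric n N) (φ : M → N) (x : M) :
    Matrix (Fin m) (Fin m) ℝ :=
  LinearMap.BilinForm.toMatrix (orthonormalFrame g x) (pullbackBilinForm h φ x)

theorem framePullback_apply (g : SmoothMetric m M) (h : SmoothMetric n N) (φ : M → N) (x : M)
    (i j : Fin m) : framePullback g h φ x i j =
      pullbackForm h φ x (orthonormalFrame g x i) (orthonormalFrame g x j) := by
  rw [framePullback, LinearMap.BilinForm.toMatrix_apply]
  rfl

theorem pullbackForm_symm (h : SmoothMetric n N) (φ : M → N) (x : M)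
    (v w : TangentSpace (𝓡 m) x) : pullbackForm h φ x v w = pullbackForm h φ x w v :=
  h.symm _ _ _

theorem framePullback_isSymm (g : SmoothMetric m M) (h : SmoothMetric n N) (φ : M → N) (x : M) :
    (framePullback g h φ x).IsSymm :=
  Matrix.IsSymm.ext fun i j => by
    rw [framePullback_apply, framePullback_apply, pullbackForm_symm]

theorem inner_self_nonneg' (h : SmoothMetric n N) (x : N) (v : TangentSpace (𝓡 n) x) :
    0 ≤ h.inner x v v := by
  rcases eq_or_ne v 0 with rfl | hv
  · simp
  · exact (h.pos x v hv).le

open Matrix in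
theorem framePullback_quadratic_nonneg (g : SmoothMetric m M) (h : SmoothMetric n N) (φ : M → N)
    (x : M) (v : Fin m → ℝ) : 0 ≤ v ⬝ᵥ (framePullback g h φ x *ᵥ v) := by
  have : v ⬝ᵥ (framePullback g h φ x *ᵥ v) =
      pullbackBilinForm h φ x (∑ i, v i • orthonormalFrame g x i)
        (∑ i, v i • orthonormalFrame g x i) := by
    simp only [map_sum, LinearMap.sum_apply, map_smul, LinearMap.smul_apply, dotProduct, mulVec,
      smul_eq_mul, Finset.mul_sum, framePullback, LinearMap.BilinForm.toMatrix_apply]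
    rw [Finset.sum_comm]
    exact Finset.sum_congr rfl fun i _ => Finset.sum_congr rfl fun j _ => by ring
  rw [this]
  exact inner_self_nonneg' h _ _

theorem orthonormalFrame_spec (g : SmoothMetric m M) (x : M) (i j : Fin m) :
    g.inner x (orthonormalFrame g x i) (orthonormalFrame g x j) = if i = j then 1 else 0 :=
  (exists_orthonormalFrame g x).choose_spec i j

theorem toMatrix_orthonormalFrame (g : SmoothMetric m M) (x : M) :
    LinearMap.BilinForm.toMatrix (orthonormalFrame g x) (metricForm g x) = 1 := by
  ext i j
  rw [LinearMap.BilinForm.toMatrix_apply, Matrix.one_apply]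
  exact orthonormalFrame_spec g x i j

theorem normSqDifferential_eq_trace (g : SmoothMetric m M) (h : SmoothMetric n N) (φ : M → N)
    (x : M) : normSqDifferential g h φ x = (framePullback g h φ x).trace := by
  simp [normSqDifferential, Matrix.trace, framePullback_apply]

theorem normSqWedgeDifferential_eq_trace (g : SmoothMetric m M) (h : SmoothMetric n N)
    (φ : M → N) (x : M) : normSqWedgeDifferential g h φ x =
      1 / 2 * ((framePullback g h φ x).trace ^ 2 -
        (framePullback g h φ x * framePullback g h φ x).trace) := by
  rw [← sum_Ioi_minors_eq _ (framePullback_isSymm g h φ x)]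
  simp only [normSqWedgeDifferential, framePullback_apply]

/-- The matrix of `φ^* h` with respect to the coordinate vector fields of the chart at `p`. -/
def coordPullback (h : SmoothMetric n N) (φ : M → N) (p : M) (y : EuclideanSpace ℝ (Fin m)) :
    Matrix (Fin m) (Fin m) ℝ :=
  Matrix.of fun i j => pullbackForm h φ ((extChartAt (𝓡 m) p).symm y)
    (mfderivWithin 𝓘(ℝ, EuclideanSpace ℝ (Fin m)) (𝓡 m) (extChartAt (𝓡 m) p).symm (range (𝓡 m)) y
      (EuclideanSpace.single i (1 : ℝ)))
    (mfderivWithin 𝓘(ℝ, EuclideanSpace ℝ (Fin m)) (𝓡 m) (extChartAt (𝓡 m) p).symm (range (𝓡 m)) y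
      (EuclideanSpace.single j (1 : ℝ)))

theorem toMatrix_coordBasis_metricForm (g : SmoothMetric m M) (p : M)
    {y : EuclideanSpace ℝ (Fin m)} (hy : y ∈ (extChartAt (𝓡 m) p).target) :
    LinearMap.BilinForm.toMatrix (coordBasis p hy) (metricForm g _) = gramMatrix g p y := by
  ext i j
  rw [LinearMap.BilinForm.toMatrix_apply, coordBasis_apply, coordBasis_apply]
  rfl

theorem toMatrix_coordBasis_pullback (h : SmoothMetric n N) (φ : M → N) (p : M)
    {y : EuclideanSpace ℝ (Fin m)} (hy : y ∈ (extChartAt (𝓡 m) p).target) :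
    LinearMap.BilinForm.toMatrix (coordBasis p hy) (pullbackBilinForm h φ _) =
      coordPullback h φ p y := by
  ext i j
  rw [LinearMap.BilinForm.toMatrix_apply, coordBasis_apply, coordBasis_apply]
  rfl

/-- The frame on the left comes from a pointwise choice with no continuity; the right side involves
only coordinate expressions, from which smoothness can be deduced. -/
theorem trace_framePullback (g : SmoothMetric m M) (h : SmoothMetric n N) (φ : M → N) (p : M)
    {y : EuclideanSpace ℝ (Fin m)} (hy : y ∈ (extChartAt (𝓡 m) p).target) :
    (framePullback g h φ ((extChartAt (𝓡 m) p).symm y)).trace =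
      ((gramMatrix g p y)⁻¹ * coordPullback h φ p y).trace := by
  rw [← toMatrix_coordBasis_metricForm g p hy, ← toMatrix_coordBasis_pullback h φ p hy,
    trace_gram_inv_mul _ _ _ _ (toMatrix_orthonormalFrame g _)]
  rfl

theorem trace_framePullback_sq (g : SmoothMetric m M) (h : SmoothMetric n N) (φ : M → N) (p : M)
    {y : EuclideanSpace ℝ (Fin m)} (hy : y ∈ (extChartAt (𝓡 m) p).target) :
    (framePullback g h φ ((extChartAt (𝓡 m) p).symm y) *
      framePullback g h φ ((extChartAt (𝓡 m) p).symm y)).trace =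
      ((gramMatrix g p y)⁻¹ * coordPullback h φ p y *
        ((gramMatrix g p y)⁻¹ * coordPullback h φ p y)).trace := by
  rw [← toMatrix_coordBasis_metricForm g p hy, ← toMatrix_coordBasis_pullback h φ p hy,
    trace_sq_gram_inv_mul _ _ _ _ (toMatrix_orthonormalFrame g _)]
  rfl

theorem det_gramMatrix_ne_zero (g : SmoothMetric m M) (p : M)
    {y : EuclideanSpace ℝ (Fin m)} (hy : y ∈ (extChartAt (𝓡 m) p).target) :
    (gramMatrix g p y).det ≠ 0 := by
  set e := orthonormalFrame g ((extChartAt (𝓡 m) p).symm y)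
  have h1 : (coordBasis p hy).toMatrix e * e.toMatrix (coordBasis p hy) = 1 :=
    (coordBasis p hy).toMatrix_mul_toMatrix_flip e
  have hdet : (e.toMatrix (coordBasis p hy)).det ≠ 0 := by
    intro h0
    have h2 := congrArg Matrix.det h1
    rw [Matrix.det_mul, Matrix.det_one] at h2
    exact right_ne_zero_of_mul_eq_one h2 h0
  rw [← toMatrix_coordBasis_metricForm g p hy,
    ← LinearMap.BilinForm.toMatrix_mul_basis_toMatrix e, toMatrix_orthonormalFrame,
    Matrix.mul_one, Matrix.det_mul, Matrix.det_transpose]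
  exact mul_ne_zero hdet hdet

end Forms

section JointSmoothness

variable {m : ℕ} {M : Type*} [TopologicalSpace M] [ChartedSpace (EuclideanSpace ℝ (Fin m)) M]
  [IsManifold (𝓡 m) ∞ M]
  {n : ℕ} {N : Type*} [TopologicalSpace N] [ChartedSpace (EuclideanSpace ℝ (Fin n)) N]
  [IsManifold (𝓡 n) ∞ N]

/-- All tangent spaces are definitionally the model space, so the same vectors make sense at both
points; this allows the base point to be rewritten. -/
theorem inner_congr_point (h : SmoothMetric n N) {a b : N} (hab : a = b)
    (v w : EuclideanSpace ℝ (Fin n)) :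
    h.inner a (v : TangentSpace (𝓡 n) a) (w : TangentSpace (𝓡 n) a) =
      h.inner b (v : TangentSpace (𝓡 n) b) (w : TangentSpace (𝓡 n) b) := by
  subst hab; rfl

/-- The coordinate expression of `ψ` in the charts around `p` and `q`. -/
def coordMap (ψ : M → N) (p : M) (q : N) (y : EuclideanSpace ℝ (Fin m)) :
    EuclideanSpace ℝ (Fin n) :=
  extChartAt (𝓡 n) q (ψ ((extChartAt (𝓡 m) p).symm y))

/-- Chain rule for the two sides of `ψ ∘ chart⁻¹ = chart⁻¹ ∘ coordMap`, valid near `y` by continuity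
of `ψ` there. -/
theorem mfderiv_coordVector (ψ : M → N) (p : M) (q : N) {y : EuclideanSpace ℝ (Fin m)}
    (hy : y ∈ (extChartAt (𝓡 m) p).target)
    (hq : ψ ((extChartAt (𝓡 m) p).symm y) ∈ (extChartAt (𝓡 n) q).source)
    (hψ : MDifferentiableAt (𝓡 m) (𝓡 n) ψ ((extChartAt (𝓡 m) p).symm y))
    (v : EuclideanSpace ℝ (Fin m)) :
    (mfderiv (𝓡 m) (𝓡 n) ψ ((extChartAt (𝓡 m) p).symm y)
      (mfderivWithin 𝓘(ℝ, EuclideanSpace ℝ (Fin m)) (𝓡 m) (extChartAt (𝓡 m) p).symm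
        (range (𝓡 m)) y v) : EuclideanSpace ℝ (Fin n)) =
    mfderivWithin 𝓘(ℝ, EuclideanSpace ℝ (Fin n)) (𝓡 n) (extChartAt (𝓡 n) q).symm
      (range (𝓡 n)) (coordMap ψ p q y) (fderiv ℝ (coordMap ψ p q) y v) := by
  have : IsManifold (𝓡 m) 1 M := IsManifold.of_le (n := ∞) (by simp)
  have : IsManifold (𝓡 n) 1 N := IsManifold.of_le (n := ∞) (by simp)
  have hc := mdifferentiableWithinAt_extChartAt_symm (I := 𝓡 m) hy
  have hd := mdifferentiableWithinAt_extChartAt_symm (I := 𝓡 n)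
    ((extChartAt (𝓡 n) q).map_source hq)
  simp only [modelWithCornersSelf_coe, range_id, mdifferentiableWithinAt_univ,
    mfderivWithin_univ] at hc hd ⊢
  have hcoord : MDifferentiableAt 𝓘(ℝ, EuclideanSpace ℝ (Fin m)) 𝓘(ℝ, EuclideanSpace ℝ (Fin n))
      (coordMap ψ p q) y :=
    (mdifferentiableAt_extChartAt (I := 𝓡 n) (by simpa [extChartAt_source] using hq)).comp y
      (hψ.comp y hc)
  have heq : ψ ∘ (extChartAt (𝓡 m) p).symm =ᶠ[𝓝 y]
      (extChartAt (𝓡 n) q).symm ∘ coordMap ψ p q := by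
    have : ContinuousAt (ψ ∘ (extChartAt (𝓡 m) p).symm) y := (hψ.comp y hc).continuousAt
    filter_upwards [this.preimage_mem_nhds ((isOpen_extChartAt_source q).mem_nhds hq)] with z hz
    exact ((extChartAt (𝓡 n) q).left_inv hz).symm
  have h1 := heq.mfderiv_eq (I := 𝓘(ℝ, EuclideanSpace ℝ (Fin m))) (I' := 𝓡 n)
  rw [mfderiv_comp y hψ hc, mfderiv_comp y hd hcoord, mfderiv_eq_fderiv] at h1
  exact congrArg (fun L : EuclideanSpace ℝ (Fin m) →L[ℝ] EuclideanSpace ℝ (Fin n) => L v) h1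

end JointSmoothness
end

/-! ### Smoothness along variations and differentiation under the integral. -/

noncomputable section

set_option linter.unusedSectionVars false
section Variations

variable {m : ℕ} {M : Type*} [TopologicalSpace M] [ChartedSpace (EuclideanSpace ℝ (Fin m)) M]
  [IsManifold (𝓡 m) ∞ M]
  {n : ℕ} {N : Type*} [TopologicalSpace N] [ChartedSpace (EuclideanSpace ℝ (Fin n)) N]
  [IsManifold (𝓡 n) ∞ N]

theorem contMDiff_of_variation {Φ : ℝ → M → N} {s : Set ℝ} (hs : IsOpen s)
    (hΦ : ContMDiffOn (𝓘(ℝ, ℝ).prod (𝓡 m)) (𝓡 n) ∞ (uncurry Φ) (s ×ˢ univ)) {t : ℝ}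
    (ht : t ∈ s) : ContMDiff (𝓡 m) (𝓡 n) ∞ (Φ t) := by
  intro x
  have h1 : ContMDiffAt (𝓘(ℝ, ℝ).prod (𝓡 m)) (𝓡 n) ∞ (uncurry Φ) (t, x) :=
    hΦ.contMDiffAt ((hs.prod isOpen_univ).mem_nhds ⟨ht, mem_univ x⟩)
  exact h1.comp x (contMDiffAt_const.prodMk contMDiffAt_id)

/-- Near `(t₀, y₀)` the entries are the metric of `N`, read in a chart at the image point, evaluated
on spatial partial derivatives of the coordinate expression of `Φ`. -/
theorem contDiffAt_coordPullback (h : SmoothMetric n N) {Φ : ℝ → M → N} {s : Set ℝ}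
    (hs : IsOpen s)
    (hΦ : ContMDiffOn (𝓘(ℝ, ℝ).prod (𝓡 m)) (𝓡 n) ∞ (uncurry Φ) (s ×ˢ univ)) (p : M) {t₀ : ℝ}
    (ht₀ : t₀ ∈ s) {y₀ : EuclideanSpace ℝ (Fin m)} (hy₀ : y₀ ∈ (extChartAt (𝓡 m) p).target)
    (i j : Fin m) :
    ContDiffAt ℝ ∞ (fun z : ℝ × EuclideanSpace ℝ (Fin m) => coordPullback h (Φ z.1) p z.2 i j)
      (t₀, y₀) := by
  set q : N := Φ t₀ ((extChartAt (𝓡 m) p).symm y₀) with hq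
  set W : Set (ℝ × EuclideanSpace ℝ (Fin m)) := s ×ˢ (extChartAt (𝓡 m) p).target
  have hW : IsOpen W := hs.prod (isOpen_extChartAt_target p)
  let F : ℝ × EuclideanSpace ℝ (Fin m) → N := fun z => Φ z.1 ((extChartAt (𝓡 m) p).symm z.2)
  have hF : ContMDiffOn 𝓘(ℝ, ℝ × EuclideanSpace ℝ (Fin m)) (𝓡 n) ∞ F W := by
    have h1 : ContMDiffOn 𝓘(ℝ, ℝ × EuclideanSpace ℝ (Fin m)) (𝓘(ℝ, ℝ).prod (𝓡 m)) ∞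
        (fun z : ℝ × EuclideanSpace ℝ (Fin m) => (z.1, (extChartAt (𝓡 m) p).symm z.2)) W :=
      (contDiff_fst.contMDiff.contMDiffOn).prodMk
        ((contMDiffOn_extChartAt_symm p).comp contDiff_snd.contMDiff.contMDiffOn fun z hz => hz.2)
    exact hΦ.comp h1 fun z hz => ⟨hz.1, mem_univ _⟩
  set U := W ∩ F ⁻¹' (extChartAt (𝓡 n) q).source with hUdef
  have hU : IsOpen U := hF.continuousOn.isOpen_inter_preimage hW (isOpen_extChartAt_source q)
  have h0U : (t₀, y₀) ∈ U := ⟨⟨ht₀, hy₀⟩, mem_extChartAt_source (I := 𝓡 n) q⟩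
  let G : ℝ × EuclideanSpace ℝ (Fin m) → EuclideanSpace ℝ (Fin n) :=
    fun z => coordMap (Φ z.1) p q z.2
  have hG : ContDiffOn ℝ ∞ G U := by
    rw [← contMDiffOn_iff_contDiffOn]
    exact (contMDiffOn_extChartAt (I := 𝓡 n) (x := q)).comp (hF.mono inter_subset_left)
      fun z hz => (extChartAt_source (𝓡 n) q) ▸ hz.2
  have hG' : ContDiffOn ℝ ∞ (fderiv ℝ G) U := hG.fderiv_of_isOpen hU (by simp)
  have hmet : ContDiffOn ℝ ∞ (fun z => metricInChart h q (G z)) U :=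
    (contDiffOn_metricInChart h q).comp hG fun z hz => (extChartAt (𝓡 n) q).map_source hz.2
  have hkey : ContDiffOn ℝ ∞ (fun z => metricInChart h q (G z)
      (fderiv ℝ G z (0, EuclideanSpace.single i (1 : ℝ)))
      (fderiv ℝ G z (0, EuclideanSpace.single j (1 : ℝ)))) U :=
    (hmet.clm_apply (hG'.clm_apply contDiffOn_const)).clm_apply (hG'.clm_apply contDiffOn_const)
  refine (hkey.contDiffAt (hU.mem_nhds h0U)).congr_of_eventuallyEq ?_
  filter_upwards [hU.mem_nhds h0U] with z hz
  have hsrc : Φ z.1 ((extChartAt (𝓡 m) p).symm z.2) ∈ (extChartAt (𝓡 n) q).source := hz.2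
  have hdiff : MDifferentiableAt (𝓡 m) (𝓡 n) (Φ z.1) ((extChartAt (𝓡 m) p).symm z.2) :=
    (contMDiff_of_variation hs hΦ hz.1.1).mdifferentiable (by simp) _
  -- The derivative at frozen time is the joint derivative in the direction `(0, v)`, so it too
  -- varies smoothly in time and space.
  have hfd : ∀ v, fderiv ℝ (coordMap (Φ z.1) p q) z.2 v = fderiv ℝ G z (0, v) := by
    intro v
    have hGz : DifferentiableAt ℝ G (z.1, z.2) :=
      (hG.contDiffAt (hU.mem_nhds hz)).differentiableAt (by simp)
    have hc := hGz.hasFDerivAt.comp z.2 (hasFDerivAt_prodMk_right z.1 z.2)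
    have : fderiv ℝ (coordMap (Φ z.1) p q) z.2 = _ := hc.fderiv
    rw [this]
    simp
  have hpt : (extChartAt (𝓡 n) q).symm (G z) = Φ z.1 ((extChartAt (𝓡 m) p).symm z.2) :=
    (extChartAt (𝓡 n) q).left_inv hsrc
  have h1 : ∀ v, _ = mfderivWithin 𝓘(ℝ, EuclideanSpace ℝ (Fin n)) (𝓡 n)
      (extChartAt (𝓡 n) q).symm (range (𝓡 n)) (G z) (fderiv ℝ G z (0, v)) := fun v =>
    (mfderiv_coordVector (Φ z.1) p q hz.1.2 hsrc hdiff v).trans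
      (congrArg (fun u => mfderivWithin 𝓘(ℝ, EuclideanSpace ℝ (Fin n)) (𝓡 n)
        (extChartAt (𝓡 n) q).symm (range (𝓡 n)) (G z) u) (hfd v))
  refine Eq.trans ?_ (metricInChart_apply h q ((extChartAt (𝓡 n) q).map_source hsrc) _ _).symm
  refine Eq.trans ?_ (inner_congr_point h hpt.symm _ _)
  exact congrArg₂ (fun v w : EuclideanSpace ℝ (Fin n) => h.inner _
    (v : TangentSpace (𝓡 n) (Φ z.1 ((extChartAt (𝓡 m) p).symm z.2))) w) (h1 _) (h1 _)

/-- `f t x` depends smoothly on `(t, x)` for `t ∈ s`: it does so in every chart. -/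
def IsJointlySmooth (m : ℕ) {M : Type*} [TopologicalSpace M]
    [ChartedSpace (EuclideanSpace ℝ (Fin m)) M] (s : Set ℝ) (f : ℝ → M → ℝ) : Prop :=
  ∀ p : M, ∀ t ∈ s, ∀ y ∈ (extChartAt (𝓡 m) p).target,
    ContDiffAt ℝ ∞ (fun z : ℝ × EuclideanSpace ℝ (Fin m) =>
      f z.1 ((extChartAt (𝓡 m) p).symm z.2)) (t, y)

theorem contDiffAt_inv_gram_mul_coordPullback (g : SmoothMetric m M) (h : SmoothMetric n N)
    {Φ : ℝ → M → N} {s : Set ℝ} (hs : IsOpen s)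
    (hΦ : ContMDiffOn (𝓘(ℝ, ℝ).prod (𝓡 m)) (𝓡 n) ∞ (uncurry Φ) (s ×ˢ univ)) (p : M) {t : ℝ}
    (ht : t ∈ s) {y : EuclideanSpace ℝ (Fin m)} (hy : y ∈ (extChartAt (𝓡 m) p).target)
    (i j : Fin m) :
    ContDiffAt ℝ ∞ (fun z : ℝ × EuclideanSpace ℝ (Fin m) =>
      ((gramMatrix g p z.2)⁻¹ * coordPullback h (Φ z.1) p z.2) i j) (t, y) := by
  refine ContDiffAt.matrix_mul (fun a b => ?_)
    (fun a b => contDiffAt_coordPullback h hs hΦ p ht hy a b) i j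
  refine ContDiffAt.matrix_inv (G := fun z : ℝ × EuclideanSpace ℝ (Fin m) => gramMatrix g p z.2)
    (fun c d => ?_) (det_gramMatrix_ne_zero g p hy) a b
  exact ContDiffAt.comp (t, y) ((contDiffOn_gramMatrix g p c d).contDiffAt
    ((isOpen_extChartAt_target p).mem_nhds hy)) contDiffAt_snd

theorem isJointlySmooth_normSqDifferential (g : SmoothMetric m M) (h : SmoothMetric n N)
    {Φ : ℝ → M → N} {s : Set ℝ} (hs : IsOpen s)
    (hΦ : ContMDiffOn (𝓘(ℝ, ℝ).prod (𝓡 m)) (𝓡 n) ∞ (uncurry Φ) (s ×ˢ univ)) :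
    IsJointlySmooth m s fun t x => normSqDifferential g h (Φ t) x := by
  intro p t ht y hy
  refine (ContDiffAt.matrix_trace fun i j =>
    contDiffAt_inv_gram_mul_coordPullback g h hs hΦ p ht hy i j).congr_of_eventuallyEq ?_
  filter_upwards [continuousAt_snd.preimage_mem_nhds
    ((isOpen_extChartAt_target p).mem_nhds hy)] with z hz
  rw [normSqDifferential_eq_trace, trace_framePullback g h _ p hz]

theorem isJointlySmooth_normSqWedgeDifferential (g : SmoothMetric m M) (h : SmoothMetric n N)
    {Φ : ℝ → M → N} {s : Set ℝ} (hs : IsOpen s)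
    (hΦ : ContMDiffOn (𝓘(ℝ, ℝ).prod (𝓡 m)) (𝓡 n) ∞ (uncurry Φ) (s ×ˢ univ)) :
    IsJointlySmooth m s fun t x => normSqWedgeDifferential g h (Φ t) x := by
  intro p t ht y hy
  have h1 := contDiffAt_inv_gram_mul_coordPullback g h hs hΦ p ht hy
  refine (contDiffAt_const (c := (1 / 2 : ℝ)).mul (((ContDiffAt.matrix_trace h1).pow 2).sub
    (ContDiffAt.matrix_trace (ContDiffAt.matrix_mul h1 h1)))).congr_of_eventuallyEq ?_
  filter_upwards [continuousAt_snd.preimage_mem_nhds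
    ((isOpen_extChartAt_target p).mem_nhds hy)] with z hz
  rw [normSqWedgeDifferential_eq_trace, trace_framePullback g h _ p hz,
    trace_framePullback_sq g h _ p hz]

namespace IsJointlySmooth

variable {s : Set ℝ} {f : ℝ → M → ℝ}

theorem mul {f' : ℝ → M → ℝ} (hf : IsJointlySmooth m s f) (hf' : IsJointlySmooth m s f') :
    IsJointlySmooth m s fun t x => f t x * f' t x :=
  fun p t ht y hy => (hf p t ht y hy).mul (hf' p t ht y hy)

theorem hasDerivAt (hf : IsJointlySmooth m s f) {t : ℝ} (ht : t ∈ s) (x : M) :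
    HasDerivAt (fun t => f t x) (deriv (fun t => f t x) t) t := by
  have h1 := (hf x t ht _ (mem_extChartAt_target (I := 𝓡 m) x)).differentiableAt (by simp)
  have h2 : DifferentiableAt ℝ (fun t' : ℝ => (t', extChartAt (𝓡 m) x x)) t := by fun_prop
  have h3 := DifferentiableAt.comp t h1 h2
  simp only [comp_def, extChartAt_to_inv] at h3
  exact h3.hasDerivAt

theorem continuousAt (hf : IsJointlySmooth m s f) {t : ℝ} (ht : t ∈ s) (x : M) :
    ContinuousAt (uncurry f) (t, x) := by
  have h1 := (hf x t ht _ (mem_extChartAt_target (I := 𝓡 m) x)).continuousAt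
  have h2 : ContinuousAt (fun z : ℝ × M => (z.1, extChartAt (𝓡 m) x z.2)) (t, x) :=
    continuousAt_fst.prodMk (ContinuousAt.comp (continuousAt_extChartAt x) continuousAt_snd)
  refine (ContinuousAt.comp (x := (t, x)) h1 h2).congr ?_
  filter_upwards [continuousAt_snd.preimage_mem_nhds
    ((isOpen_extChartAt_source (I := 𝓡 m) x).mem_nhds (mem_extChartAt_source x))] with z hz
  simp only [comp_def, uncurry]
  rw [(extChartAt (𝓡 m) x).left_inv hz]

theorem continuous (hf : IsJointlySmooth m s f) {t : ℝ} (ht : t ∈ s) : Continuous (f t) :=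
  continuous_iff_continuousAt.mpr fun x =>
    ContinuousAt.comp (f := fun x => (t, x)) (hf.continuousAt ht x) (by fun_prop)

/-- In a chart the time derivative is the joint derivative in the direction `(1, 0)`. -/
theorem continuousAt_deriv (hf : IsJointlySmooth m s f) {t : ℝ} (ht : t ∈ s)
    (x : M) : ContinuousAt (fun z : ℝ × M => deriv (fun t => f t z.2) z.1) (t, x) := by
  have h0 := hf x t ht _ (mem_extChartAt_target (I := 𝓡 m) x)
  set F : ℝ × EuclideanSpace ℝ (Fin m) → ℝ := fun z => f z.1 ((extChartAt (𝓡 m) x).symm z.2)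
  have h1 : ContinuousAt (fun z => fderiv ℝ F z (1, 0)) (t, extChartAt (𝓡 m) x x) :=
    ((h0.fderiv_right (m := 0) (by simp)).continuousAt).clm_apply continuousAt_const
  have h2 : ContinuousAt (fun z : ℝ × M => (z.1, extChartAt (𝓡 m) x z.2)) (t, x) :=
    continuousAt_fst.prodMk (ContinuousAt.comp (continuousAt_extChartAt x) continuousAt_snd)
  have hev : ∀ᶠ z in 𝓝 (t, extChartAt (𝓡 m) x x), DifferentiableAt ℝ F z :=
    ((h0.of_le (m := 1) (by simp)).eventually (by simp)).mono
      fun z hz => hz.differentiableAt (by simp)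
  refine (ContinuousAt.comp (x := (t, x)) h1 h2).congr ?_
  filter_upwards [h2.eventually hev, continuousAt_snd.preimage_mem_nhds
    ((isOpen_extChartAt_source (I := 𝓡 m) x).mem_nhds (mem_extChartAt_source x))] with z hz hz'
  have h3 : HasDerivAt (fun t' : ℝ => (t', extChartAt (𝓡 m) x z.2))
      ((1 : ℝ), (0 : EuclideanSpace ℝ (Fin m))) z.1 :=
    (hasDerivAt_id z.1).prodMk (hasDerivAt_const z.1 _)
  have h4 := HasFDerivAt.comp_hasDerivAt z.1 hz.hasFDerivAt h3
  have h5 : F ∘ (fun t' : ℝ => (t', extChartAt (𝓡 m) x z.2)) = fun t => f t z.2 := by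
    funext t'
    simp only [F, comp_def]
    rw [(extChartAt (𝓡 m) x).left_inv hz']
  rw [h5] at h4
  exact h4.deriv.symm

theorem continuous_deriv (hf : IsJointlySmooth m s f) {t : ℝ} (ht : t ∈ s) :
    Continuous fun x => deriv (fun t => f t x) t :=
  continuous_iff_continuousAt.mpr fun x =>
    ContinuousAt.comp (f := fun x => (t, x)) (hf.continuousAt_deriv ht x) (by fun_prop)

/-- Dominated differentiation: the time derivative is jointly continuous, hence bounded on a compact
time interval times `D`, and constants are integrable because `μ D` is finite. -/
theorem hasDerivAt_setIntegral [T2Space M] [MeasurableSpace M] [BorelSpace M] {ε : ℝ} (hε : 0 < ε)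
    (hf : IsJointlySmooth m (Ioo (-ε) ε) f) {μ : Measure M} {D : Set M} (hD : IsCompact D)
    (hμ : μ D < ⊤) :
    HasDerivAt (fun t => ∫ x in D, f t x ∂μ) (∫ x in D, deriv (fun t => f t x) 0 ∂μ) 0 := by
  have h0 : (0 : ℝ) ∈ Ioo (-ε) ε := ⟨by linarith, hε⟩
  have : IsFiniteMeasure (μ.restrict D) := ⟨by simpa using hμ⟩
  -- A smaller closed interval is used to have compactness in time.
  set I := Icc (-(ε / 2)) (ε / 2)
  have hI : I ⊆ Ioo (-ε) ε := fun t ht => ⟨by linarith [ht.1], by linarith [ht.2]⟩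
  have hI0 : I ∈ 𝓝 (0 : ℝ) := Icc_mem_nhds (by linarith) (by linarith)
  obtain ⟨C, hC⟩ := (isCompact_Icc.prod hD : IsCompact (I ×ˢ D)).exists_bound_of_continuousOn
    (f := fun z : ℝ × M => deriv (fun t => f t z.2) z.1)
    fun z hz => (hf.continuousAt_deriv (hI hz.1) z.2).continuousWithinAt
  obtain ⟨C', hC'⟩ := hD.exists_bound_of_continuousOn (hf.continuous h0).continuousOn
  refine (hasDerivAt_integral_of_dominated_loc_of_deriv_le (F := f)
    (F' := fun t x => deriv (fun t => f t x) t) (bound := fun _ => C) hI0 ?_ ?_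
    (hf.continuous_deriv h0).aestronglyMeasurable ?_ (integrable_const C) ?_).2
  · filter_upwards [hI0] with t ht
    exact (hf.continuous (hI ht)).aestronglyMeasurable
  · exact Integrable.of_bound (hf.continuous h0).aestronglyMeasurable C'
      (ae_restrict_of_forall_mem hD.measurableSet hC')
  · exact ae_restrict_of_forall_mem hD.measurableSet fun x hx t ht => hC (t, x) ⟨ht, hx⟩
  · exact Filter.Eventually.of_forall fun x t ht => hf.hasDerivAt (hI ht) x

end IsJointlySmooth

end Variations
end

/-! ### The Riemannian measure: finiteness on compact sets and conformal change. -/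

noncomputable section

set_option linter.unusedSectionVars false

theorem MeasureTheory.Measure.map_withDensity_mul_comp {α β : Type*} [MeasurableSpace α]
    [MeasurableSpace β] {μ : Measure α} {c : α → β} (hc : AEMeasurable c μ) {w : α → ENNReal}
    (hw : AEMeasurable w μ) {u : β → ENNReal} (hu : Measurable u) :
    (μ.withDensity fun y => w y * u (c y)).map c = ((μ.withDensity w).map c).withDensity u := by
  have hcw : AEMeasurable c (μ.withDensity w) := hc.mono_ac (withDensity_absolutelyContinuous _ _)
  have hcw' : AEMeasurable c (μ.withDensity fun y => w y * u (c y)) :=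
    hc.mono_ac (withDensity_absolutelyContinuous _ _)
  ext A hA
  have hmeas : AEMeasurable (fun y => A.indicator u (c y)) μ :=
    (hu.indicator hA).comp_aemeasurable hc
  rw [← lintegral_indicator_one hA, lintegral_map' (measurable_one.indicator hA).aemeasurable hcw',
    withDensity_apply _ hA, ← lintegral_indicator hA,
    lintegral_map' (hu.indicator hA).aemeasurable hcw,
    lintegral_withDensity_eq_lintegral_mul₀ hw hmeas,
    lintegral_withDensity_eq_lintegral_mul₀ (f := fun y => w y * u (c y))
      (hw.mul (hu.comp_aemeasurable hc)) (g := fun y => A.indicator 1 (c y))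
      ((measurable_one.indicator hA).comp_aemeasurable hc)]
  refine lintegral_congr fun y => ?_
  by_cases hy : c y ∈ A <;> simp [hy]

section RiemannianMeasure

variable {m : ℕ} {M : Type*} [TopologicalSpace M] [ChartedSpace (EuclideanSpace ℝ (Fin m)) M]
  [IsManifold (𝓡 m) ∞ M] [T2Space M] [SigmaCompactSpace M]

theorem continuousOn_sqrt_det_gramMatrix (g : SmoothMetric m M) (p : M) :
    ContinuousOn (fun y => Real.sqrt (gramMatrix g p y).det) (extChartAt (𝓡 m) p).target := by
  intro y hy
  refine ContinuousAt.continuousWithinAt (Real.continuous_sqrt.continuousAt.comp ?_)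
  exact (ContDiffAt.matrix_det (k := ∞) fun i j => (contDiffOn_gramMatrix g p i j).contDiffAt
    ((isOpen_extChartAt_target p).mem_nhds hy)).continuousAt

theorem continuousOn_chartDensity (g : SmoothMetric m M) (p : M) :
    ContinuousOn (fun y => chartPartition m M p ((extChartAt (𝓡 m) p).symm y) *
      Real.sqrt (gramMatrix g p y).det) (extChartAt (𝓡 m) p).target :=
  ((chartPartition m M p).contMDiff.continuous.comp_continuousOn
    (continuousOn_extChartAt_symm p)).mul (continuousOn_sqrt_det_gramMatrix g p)

variable [MeasurableSpace M] [BorelSpace M]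

theorem aemeasurable_extChartAt_symm (p : M) :
    AEMeasurable (extChartAt (𝓡 m) p).symm
      ((volume : Measure (EuclideanSpace ℝ (Fin m))).restrict (extChartAt (𝓡 m) p).target) :=
  (continuousOn_extChartAt_symm p).aemeasurable (isOpen_extChartAt_target p).measurableSet

/-- By local finiteness only finitely many functions of the partition meet `D`. Each of them
contributes the integral of a density that is continuous in the chart and vanishes on the relevant
domain outside a compact subset of the chart target. -/
theorem riemannianMeasure_lt_top (g : SmoothMetric m M) {D : Set M} (hD : IsCompact D) :
    riemannianMeasure g D < ⊤ := by
  let w : M → EuclideanSpace ℝ (Fin m) → ENNReal := fun p y => ENNReal.ofReal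
    (chartPartition m M p ((extChartAt (𝓡 m) p).symm y) * Real.sqrt (gramMatrix g p y).det)
  let A : M → Set (EuclideanSpace ℝ (Fin m)) := fun p =>
    (extChartAt (𝓡 m) p).symm ⁻¹' D ∩ (extChartAt (𝓡 m) p).target
  have hA : ∀ p, MeasurableSet (A p) := by
    intro p
    have h1 : A p = (extChartAt (𝓡 m) p).target \
        ((extChartAt (𝓡 m) p).target ∩ (extChartAt (𝓡 m) p).symm ⁻¹' Dᶜ) := by
      ext y; simp only [A, mem_inter_iff, mem_preimage, mem_sdiff, mem_compl_iff]; tauto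
    rw [h1]
    exact (isOpen_extChartAt_target p).measurableSet.diff
      ((continuousOn_extChartAt_symm p).isOpen_inter_preimage (isOpen_extChartAt_target p)
        hD.isClosed.isOpen_compl).measurableSet
  have hval : ∀ p, (((volume : Measure (EuclideanSpace ℝ (Fin m))).restrict
      (extChartAt (𝓡 m) p).target).withDensity (w p)).map (extChartAt (𝓡 m) p).symm D =
        ∫⁻ y in A p, w p y := by
    intro p
    rw [Measure.map_apply_of_aemeasurable ((aemeasurable_extChartAt_symm p).mono_ac
      (withDensity_absolutelyContinuous _ _)) hD.measurableSet, withDensity_apply',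
      Measure.restrict_restrict' (isOpen_extChartAt_target p).measurableSet]
  set S : Set M := {p | (support (chartPartition m M p) ∩ D).Nonempty}
  have hS : S.Finite := (chartPartition m M).locallyFinite.finite_nonempty_inter_compact hD
  have hout : ∀ p ∉ hS.toFinset, ∫⁻ y in A p, w p y = 0 := by
    intro p hp
    have hp' : ∀ x ∈ D, chartPartition m M p x = 0 := by
      intro x hx
      by_contra h0
      exact hp (hS.mem_toFinset.mpr ⟨x, h0, hx⟩)
    rw [setLIntegral_congr_fun (hA p) (g := fun _ => 0), lintegral_zero]
    intro y hy
    simp only [w]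
    rw [hp' _ hy.1, zero_mul, ENNReal.ofReal_zero]
  rw [riemannianMeasure, Measure.sum_apply _ hD.measurableSet, tsum_congr hval,
    tsum_eq_sum hout]
  refine ENNReal.sum_lt_top.mpr fun p _ => ?_
  -- The closed support makes `T` compact, and subordination keeps it inside the chart domain.
  set T := D ∩ tsupport (chartPartition m M p)
  have hT : IsCompact T := hD.inter_right (isClosed_tsupport _)
  have hTsrc : T ⊆ (extChartAt (𝓡 m) p).source := fun x hx => by
    rw [extChartAt_source]; exact chartPartition_isSubordinate m M p hx.2
  set L := extChartAt (𝓡 m) p '' T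
  have hL : IsCompact L := hT.image_of_continuousOn ((continuousOn_extChartAt p).mono hTsrc)
  have hLtgt : L ⊆ (extChartAt (𝓡 m) p).target := by
    rintro _ ⟨x, hx, rfl⟩
    exact (extChartAt (𝓡 m) p).map_source (hTsrc hx)
  obtain ⟨C, hC⟩ := hL.exists_bound_of_continuousOn ((continuousOn_chartDensity g p).mono hLtgt)
  calc ∫⁻ y in A p, w p y ≤ ∫⁻ y in A p, L.indicator (fun _ => ENNReal.ofReal C) y := by
        refine setLIntegral_mono' (hA p) fun y hy => ?_
        by_cases hyL : y ∈ L
        · rw [indicator_of_mem hyL]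
          exact ENNReal.ofReal_le_ofReal ((le_abs_self _).trans (hC y hyL))
        · have h0 : chartPartition m M p ((extChartAt (𝓡 m) p).symm y) = 0 := by
            by_contra h0
            exact hyL ⟨_, ⟨hy.1, subset_tsupport _ h0⟩, (extChartAt (𝓡 m) p).right_inv hy.2⟩
          simp only [w]
          rw [h0, zero_mul, ENNReal.ofReal_zero]
          exact zero_le
    _ ≤ ∫⁻ y, L.indicator (fun _ => ENNReal.ofReal C) y := setLIntegral_le_lintegral _ _
    _ = ENNReal.ofReal C * volume L := by
        rw [lintegral_indicator_const hL.measurableSet]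
    _ < ⊤ := ENNReal.mul_lt_top ENNReal.ofReal_lt_top hL.measure_lt_top

theorem gramMatrix_of_isConformalChange {f : M → ℝ} {g g' : SmoothMetric m M}
    (hg : IsConformalChange f g g') (p : M) (y : EuclideanSpace ℝ (Fin m)) :
    gramMatrix g' p y = f ((extChartAt (𝓡 m) p).symm y) • gramMatrix g p y := by
  ext i j
  exact (hg _).2 _ _

/-- The determinant of the Gram matrix scales by `f^m`, its square root by `f^(m/2)`. The partition
of unity does not depend on the metric, so the two sums are compared chart by chart. -/
theorem riemannianMeasure_of_isConformalChange {f : M → ℝ} {g g' : SmoothMetric m M}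
    (hg : IsConformalChange f g g') (hf : Continuous f) :
    riemannianMeasure g' =
      (riemannianMeasure g).withDensity fun x => ENNReal.ofReal (f x ^ ((m : ℝ) / 2)) := by
  have hu : Measurable fun x => ENNReal.ofReal (f x ^ ((m : ℝ) / 2)) :=
    (hf.rpow_const fun x => Or.inl (hg x).1.ne').measurable.ennreal_ofReal
  rw [riemannianMeasure, riemannianMeasure, withDensity_sum]
  congr 1
  funext p
  rw [← Measure.map_withDensity_mul_comp (aemeasurable_extChartAt_symm p)
    ((continuousOn_chartDensity g p).aemeasurable
      (isOpen_extChartAt_target p).measurableSet).ennreal_ofReal hu]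
  congr 2
  funext y
  have hpos := (hg ((extChartAt (𝓡 m) p).symm y)).1
  rw [gramMatrix_of_isConformalChange hg, Matrix.det_smul, Fintype.card_fin,
    Real.sqrt_mul (pow_nonneg hpos.le _), ← ENNReal.ofReal_mul (mul_nonneg
      ((chartPartition m M).nonneg _ _) (Real.sqrt_nonneg _))]
  congr 1
  have hs : Real.sqrt (f ((extChartAt (𝓡 m) p).symm y) ^ m) =
      f ((extChartAt (𝓡 m) p).symm y) ^ ((m : ℝ) / 2) := by
    rw [Real.sqrt_eq_rpow, ← Real.rpow_natCast, ← Real.rpow_mul hpos.le]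
    ring_nf
  rw [hs]
  ring

end RiemannianMeasure
end

/-! ### Horizontally conformal maps and their first variation. -/

noncomputable section

set_option linter.unusedSectionVars false

section HorizontallyConformal

variable {m : ℕ} {M : Type*} [TopologicalSpace M] [ChartedSpace (EuclideanSpace ℝ (Fin m)) M]
  [IsManifold (𝓡 m) ∞ M]
  {n : ℕ} {N : Type*} [TopologicalSpace N] [ChartedSpace (EuclideanSpace ℝ (Fin n)) N]
  [IsManifold (𝓡 n) ∞ N]

theorem orthonormalFrame_repr (g : SmoothMetric m M) (x : M) (v : TangentSpace (𝓡 m) x)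
    (i : Fin m) : (orthonormalFrame g x).repr v i = g.inner x (orthonormalFrame g x i) v := by
  conv_rhs => rw [← (orthonormalFrame g x).sum_repr v]
  simp only [map_sum, map_smul, orthonormalFrame_spec, smul_eq_mul, mul_ite, mul_one, mul_zero,
    Finset.sum_ite_eq, Finset.mem_univ, if_true]

theorem inner_eq_sum_orthonormalFrame (g : SmoothMetric m M) (x : M)
    (v w : TangentSpace (𝓡 m) x) : g.inner x v w =
      ∑ i, g.inner x (orthonormalFrame g x i) v * g.inner x (orthonormalFrame g x i) w := by
  conv_lhs => rw [← (orthonormalFrame g x).sum_repr v]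
  simp [map_sum, orthonormalFrame_repr]

/-- The matrix of the differential of `φ` with respect to orthonormal frames. -/
def frameDifferential (g : SmoothMetric m M) (h : SmoothMetric n N) (φ : M → N) (x : M) :
    Matrix (Fin n) (Fin m) ℝ :=
  Matrix.of fun k i => h.inner (φ x) (orthonormalFrame h (φ x) k)
    (mfderiv (𝓡 m) (𝓡 n) φ x (orthonormalFrame g x i))

open Matrix in
theorem framePullback_eq_transpose_mul (g : SmoothMetric m M) (h : SmoothMetric n N)
    (φ : M → N) (x : M) :
    framePullback g h φ x = (frameDifferential g h φ x)ᵀ * frameDifferential g h φ x := by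
  ext i j
  rw [framePullback_apply, pullbackForm, inner_eq_sum_orthonormalFrame, Matrix.mul_apply]
  rfl

theorem frameDifferential_mulVec_repr (g : SmoothMetric m M) (h : SmoothMetric n N)
    (φ : M → N) (x : M) (c : Fin m → ℝ) (k : Fin n) :
    (frameDifferential g h φ x).mulVec c k = h.inner (φ x) (orthonormalFrame h (φ x) k)
      (mfderiv (𝓡 m) (𝓡 n) φ x (∑ i, c i • orthonormalFrame g x i)) := by
  simp only [Matrix.mulVec, dotProduct, frameDifferential, Matrix.of_apply, map_sum, map_smul,
    smul_eq_mul]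
  exact Finset.sum_congr rfl fun i _ => mul_comm _ _

open Matrix in
-- The adjoint of the differential takes values in horizontal vectors. Conformality on the images of
-- an orthonormal frame gives `(l lᵀ)ᵀ (l lᵀ) = λ² l lᵀ`, and surjectivity cancels one factor.
theorem IsHorizontallyConformal.frameDifferential_mul_transpose {g : SmoothMetric m M}
    {h : SmoothMetric n N} {φ : M → N} {lam : M → ℝ} (hφ : IsHorizontallyConformal g h φ lam)
    (x : M) : frameDifferential g h φ x * (frameDifferential g h φ x)ᵀ = lam x ^ 2 • 1 := by
  set l := frameDifferential g h φ x with hl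
  -- `u k` is the adjoint of the differential applied to the `k`-th frame vector, as `hgu`
  -- expresses.
  let u : Fin n → TangentSpace (𝓡 m) x := fun k => ∑ i, l k i • orthonormalFrame g x i
  have hgu : ∀ v k, g.inner x v (u k) = h.inner (φ x) (orthonormalFrame h (φ x) k)
      (mfderiv (𝓡 m) (𝓡 n) φ x v) := by
    intro v k
    conv_rhs => rw [← (orthonormalFrame g x).sum_repr v]
    rw [← frameDifferential_mulVec_repr]
    simp only [u, map_sum, map_smul, smul_eq_mul, Matrix.mulVec, dotProduct, ← hl]
    exact Finset.sum_congr rfl fun i _ => by rw [orthonormalFrame_repr, g.symm]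
  have hhor : ∀ k v, mfderiv (𝓡 m) (𝓡 n) φ x v = 0 → g.inner x v (u k) = 0 := by
    intro k v hv
    rw [hgu, hv, map_zero]
  have hB : ∀ a k, h.inner (φ x) (orthonormalFrame h (φ x) a) (mfderiv (𝓡 m) (𝓡 n) φ x (u k)) =
      (l * lᵀ) a k := by
    intro a k
    rw [← frameDifferential_mulVec_repr, ← hl]
    rfl
  refine mul_transpose_eq_smul_one l (fun c => ?_) ?_
  · obtain ⟨v, hv⟩ := hφ.surjective x (∑ k, c k • orthonormalFrame h (φ x) k)
    refine ⟨fun i => (orthonormalFrame g x).repr v i, ?_⟩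
    funext k
    rw [hl, frameDifferential_mulVec_repr, (orthonormalFrame g x).sum_repr v, hv]
    simp [map_sum, orthonormalFrame_spec]
  · ext k k'
    have h1 := hφ.conformal x (u k) (u k') (hhor k) (hhor k')
    rw [hgu, hB, inner_eq_sum_orthonormalFrame] at h1
    simp only [hB] at h1
    rw [Matrix.mul_apply, Matrix.smul_apply, smul_eq_mul]
    simp only [Matrix.transpose_apply (l * lᵀ)]
    rw [h1]
    congr 1
    rw [← Matrix.transpose_apply (l * lᵀ), Matrix.transpose_mul, Matrix.transpose_transpose]

theorem IsHorizontallyConformal.trace_framePullback {g : SmoothMetric m M}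
    {h : SmoothMetric n N} {φ : M → N} {lam : M → ℝ} (hφ : IsHorizontallyConformal g h φ lam)
    (x : M) : (framePullback g h φ x).trace = n * lam x ^ 2 := by
  rw [framePullback_eq_transpose_mul, Matrix.trace_mul_comm, hφ.frameDifferential_mul_transpose,
    Matrix.trace_smul, Matrix.trace_one, Fintype.card_fin, smul_eq_mul, mul_comm]

theorem IsHorizontallyConformal.framePullback_mul_self {g : SmoothMetric m M}
    {h : SmoothMetric n N} {φ : M → N} {lam : M → ℝ} (hφ : IsHorizontallyConformal g h φ lam)
    (x : M) : framePullback g h φ x * framePullback g h φ x =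
      lam x ^ 2 • framePullback g h φ x := by
  rw [framePullback_eq_transpose_mul, Matrix.mul_assoc,
    ← Matrix.mul_assoc (frameDifferential g h φ x), hφ.frameDifferential_mul_transpose,
    Matrix.smul_mul, Matrix.one_mul, Matrix.mul_smul]

/-- The point is fixed, so the frame does not move with `t` and the matrix is a constant congruence
of the coordinate one. -/
theorem differentiableAt_framePullback (g : SmoothMetric m M) (h : SmoothMetric n N)
    {Φ : ℝ → M → N} {s : Set ℝ} (hs : IsOpen s)
    (hΦ : ContMDiffOn (𝓘(ℝ, ℝ).prod (𝓡 m)) (𝓡 n) ∞ (uncurry Φ) (s ×ˢ univ)) {t : ℝ}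
    (ht : t ∈ s) (x : M) (i j : Fin m) :
    DifferentiableAt ℝ (fun t => framePullback g h (Φ t) x i j) t := by
  obtain ⟨p, y, hy, rfl⟩ : ∃ p : M, ∃ y ∈ (extChartAt (𝓡 m) p).target,
      x = (extChartAt (𝓡 m) p).symm y :=
    ⟨x, _, mem_extChartAt_target x, (extChartAt_to_inv x).symm⟩
  have hcoord : ∀ a b, DifferentiableAt ℝ (fun t => coordPullback h (Φ t) p y a b) t := by
    intro a b
    have h1 := (contDiffAt_coordPullback h hs hΦ p ht hy a b).differentiableAt (by simp)
    have h2 : DifferentiableAt ℝ (fun t' : ℝ => (t', y)) t := by fun_prop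
    exact DifferentiableAt.comp t h1 h2
  set P := (coordBasis p hy).toMatrix (orthonormalFrame g ((extChartAt (𝓡 m) p).symm y))
  have hconj : ∀ t, framePullback g h (Φ t) ((extChartAt (𝓡 m) p).symm y) =
      P.transpose * coordPullback h (Φ t) p y * P := by
    intro t
    rw [framePullback, ← LinearMap.BilinForm.toMatrix_mul_basis_toMatrix (coordBasis p hy),
      toMatrix_coordBasis_pullback]
  simp only [hconj, Matrix.mul_apply]
  exact DifferentiableAt.fun_sum fun a _ => (DifferentiableAt.fun_sum fun b _ =>
    (hcoord b a).const_mul _).mul_const _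

/-- Only `Φ 0` has to be horizontally conformal: at other times the argument uses nothing but
nonnegativity of the pulled back form. -/
theorem hasDerivAt_normSqWedgeDifferential {g : SmoothMetric m M}
    {h : SmoothMetric n N} {φ : M → N} {lam : M → ℝ} (hφ : IsHorizontallyConformal g h φ lam)
    {Φ : ℝ → M → N} {s : Set ℝ} (hs : IsOpen s)
    (hΦ : ContMDiffOn (𝓘(ℝ, ℝ).prod (𝓡 m)) (𝓡 n) ∞ (uncurry Φ) (s ×ˢ univ)) (h0 : 0 ∈ s)
    (hΦ0 : Φ 0 = φ) (x : M) :
    HasDerivAt (fun t => normSqWedgeDifferential g h (Φ t) x)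
      (((n : ℝ) - 1) * lam x ^ 2 * deriv (fun t => normSqDifferential g h (Φ t) x) 0) 0 := by
  have hder : ∀ i j, HasDerivAt (fun t => framePullback g h (Φ t) x i j)
      (deriv (fun t => framePullback g h (Φ t) x i j) 0) 0 :=
    fun i j => (differentiableAt_framePullback g h hs hΦ h0 x i j).hasDerivAt
  have htr : HasDerivAt (fun t => normSqDifferential g h (Φ t) x)
      (Matrix.of fun i j => deriv (fun t => framePullback g h (Φ t) x i j) 0).trace 0 := by
    simp only [normSqDifferential_eq_trace, Matrix.trace, Matrix.diag_apply, Matrix.of_apply]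
    exact HasDerivAt.fun_sum fun i _ => hder i i
  simp only [normSqWedgeDifferential_eq_trace]
  rw [htr.deriv]
  refine hasDerivAt_sum_minors (pow_ne_zero 2 (hφ.dilation_ne_zero x)) (fun i j => hder i j)
    (framePullback_isSymm g h _ x)
    (Filter.Eventually.of_forall fun t => framePullback_quadratic_nonneg g h _ x) ?_ ?_
  · rw [hΦ0, hφ.framePullback_mul_self]
  · rw [hΦ0, hφ.trace_framePullback]

end HorizontallyConformal

/-! ### Conformal change of the metric and of the Dirichlet energy. -/

section Conformal

variable {m : ℕ} {M : Type*} [TopologicalSpace M] [ChartedSpace (EuclideanSpace ℝ (Fin m)) M]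
  [IsManifold (𝓡 m) ∞ M]
  {n : ℕ} {N : Type*} [TopologicalSpace N] [ChartedSpace (EuclideanSpace ℝ (Fin n)) N]
  [IsManifold (𝓡 n) ∞ N]

theorem exists_isConformalChange (g : SmoothMetric m M) {f : M → ℝ}
    (hf : ContMDiff (𝓡 m) 𝓘(ℝ, ℝ) ∞ f) (hpos : ∀ x, 0 < f x) :
    ∃ g' : SmoothMetric m M, IsConformalChange f g g' := by
  have hadd : ∀ x : M, ContinuousAdd (TangentSpace (𝓡 m) x →L[ℝ] ℝ) :=
    fun x => IsTopologicalAddGroup.toContinuousAdd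
  refine ⟨{ inner := fun x => f x • g.inner x
            symm := fun x v w => ?_
            pos := fun x v hv => ?_
            isVonNBounded := fun x => ?_
            contMDiff := hf.smul_section g.contMDiff }, fun x => ⟨hpos x, fun v w => rfl⟩⟩
  · exact congrArg (f x * ·) (g.symm x v w)
  · exact mul_pos (hpos x) (g.pos x v hv)
  -- The unit ball of the new metric is contained in the image of the old one under scaling by
  -- `1/√f`.
  · have hc : Real.sqrt (f x) ≠ 0 := (Real.sqrt_pos.mpr (hpos x)).ne'
    refine Bornology.IsVonNBounded.subset (fun v hv => ?_)
      (Bornology.IsVonNBounded.image (g.isVonNBounded x)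
        ((Real.sqrt (f x))⁻¹ • ContinuousLinearMap.id ℝ (TangentSpace (𝓡 m) x)))
    refine ⟨Real.sqrt (f x) • v, ?_, inv_smul_smul₀ hc v⟩
    have : g.inner x (Real.sqrt (f x) • v) (Real.sqrt (f x) • v) = f x * g.inner x v v := by
      simp only [map_smul, smul_apply, smul_eq_mul]
      rw [← mul_assoc, Real.mul_self_sqrt (hpos x).le]
    rw [mem_ofPred_eq, this]
    exact hv

theorem normSqDifferential_of_isConformalChange {f : M → ℝ} {g g' : SmoothMetric m M}
    (hg : IsConformalChange f g g') (h : SmoothMetric n N) (ψ : M → N) (x : M) :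
    normSqDifferential g' h ψ x = (f x)⁻¹ * normSqDifferential g h ψ x := by
  have hf := (hg x).1.ne'
  have hgram : LinearMap.BilinForm.toMatrix (orthonormalFrame g' x) (metricForm g x) =
      (f x)⁻¹ • 1 := by
    ext i j
    rw [LinearMap.BilinForm.toMatrix_apply, Matrix.smul_apply, Matrix.one_apply,
      ← orthonormalFrame_spec g' x i j, (hg x).2, smul_eq_mul, inv_mul_cancel_left₀ hf]
    rfl
  rw [normSqDifferential_eq_trace g, framePullback,
    ← trace_gram_inv_mul _ (orthonormalFrame g' x) _ _ (toMatrix_orthonormalFrame g x), hgram,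
    Matrix.inv_eq_left_inv (B := f x • 1), Matrix.smul_mul, Matrix.one_mul, Matrix.trace_smul,
    smul_eq_mul, inv_mul_cancel_left₀ hf, normSqDifferential_eq_trace]
  · rfl
  · rw [Matrix.smul_mul, Matrix.one_mul, smul_smul, mul_inv_cancel₀ hf, one_smul]

variable [T2Space M] [SigmaCompactSpace M] [MeasurableSpace M] [BorelSpace M]

/-- The exponent is `m/2` from the measure minus `1` from the norm of the differential. -/
theorem sigma1Energy_of_isConformalChange {f : M → ℝ} {g g' : SmoothMetric m M}
    (hg : IsConformalChange f g g') (hf : Continuous f) (h : SmoothMetric n N) (ψ : M → N)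
    {D : Set M} (hD : MeasurableSet D) :
    sigma1Energy g' h ψ D = 1 / 2 * ∫ x in D, f x ^ (((m : ℝ) - 2) / 2) *
      normSqDifferential g h ψ x ∂(riemannianMeasure g) := by
  have hu : Measurable fun x => ENNReal.ofReal (f x ^ ((m : ℝ) / 2)) :=
    (hf.rpow_const fun x => Or.inl (hg x).1.ne').measurable.ennreal_ofReal
  rw [sigma1Energy, riemannianMeasure_of_isConformalChange hg hf,
    setIntegral_withDensity_eq_setIntegral_toReal_smul hu
      (Filter.Eventually.of_forall fun _ => ENNReal.ofReal_lt_top) _ hD]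
  congr 1
  refine integral_congr_ae (Filter.Eventually.of_forall fun x => ?_)
  have hpos := (hg x).1
  simp only [smul_eq_mul]
  rw [ENNReal.toReal_ofReal (Real.rpow_nonneg hpos.le _),
    normSqDifferential_of_isConformalChange hg, ← mul_assoc]
  congr 1
  rw [show ((m : ℝ) - 2) / 2 = m / 2 - 1 by ring, Real.rpow_sub_one hpos.ne', div_eq_mul_inv _ (f x)]

end Conformal
end

/-! ### Comparison of first variations and the main theorem. -/

noncomputable section

set_option linter.unusedSectionVars false

theorem integrableOn_of_continuous {M : Type*} [TopologicalSpace M] [T2Space M]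
    [MeasurableSpace M] [BorelSpace M] {μ : Measure M} {D : Set M} (hD : IsCompact D) (hμ : μ D < ⊤)
    {f : M → ℝ} (hf : Continuous f) : IntegrableOn f D μ := by
  have : IsFiniteMeasure (μ.restrict D) := ⟨by simpa using hμ⟩
  obtain ⟨C, hC⟩ := hD.exists_bound_of_continuousOn hf.continuousOn
  exact Integrable.of_bound hf.aestronglyMeasurable C
    (ae_restrict_of_forall_mem hD.measurableSet hC)

section Criticality

variable {m : ℕ} {M : Type*} [TopologicalSpace M] [ChartedSpace (EuclideanSpace ℝ (Fin m)) M]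
  [IsManifold (𝓡 m) ∞ M]
  {n : ℕ} {N : Type*} [TopologicalSpace N] [ChartedSpace (EuclideanSpace ℝ (Fin n)) N]
  [IsManifold (𝓡 n) ∞ N]

theorem isJointlySmooth_of_contMDiff {f : M → ℝ} (hf : ContMDiff (𝓡 m) 𝓘(ℝ, ℝ) ∞ f)
    (s : Set ℝ) : IsJointlySmooth m s fun _ => f := by
  intro p t _ y hy
  have h1 : ContMDiffOn 𝓘(ℝ, EuclideanSpace ℝ (Fin m)) 𝓘(ℝ, ℝ) ∞
      (f ∘ (extChartAt (𝓡 m) p).symm) (extChartAt (𝓡 m) p).target :=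
    hf.comp_contMDiffOn (contMDiffOn_extChartAt_symm p)
  exact ContDiffAt.comp (g := f ∘ (extChartAt (𝓡 m) p).symm) (t, y)
    ((contMDiffOn_iff_contDiffOn.mp h1).contDiffAt
      ((isOpen_extChartAt_target p).mem_nhds hy)) contDiffAt_snd

theorem IsJointlySmooth.contMDiff {s : Set ℝ} {f : ℝ → M → ℝ} (hf : IsJointlySmooth m s f)
    {t : ℝ} (ht : t ∈ s) : ContMDiff (𝓡 m) 𝓘(ℝ, ℝ) ∞ (f t) := by
  intro x
  have h1 : ContDiffAt ℝ ∞ (fun y => f t ((extChartAt (𝓡 m) x).symm y)) (extChartAt (𝓡 m) x x) :=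
    ContDiffAt.comp (f := fun y => (t, y)) _ (hf x t ht _ (mem_extChartAt_target x)) (by fun_prop)
  refine (h1.contMDiffAt.comp x contMDiffAt_extChartAt).congr_of_eventuallyEq ?_
  filter_upwards [(isOpen_extChartAt_source (I := 𝓡 m) x).mem_nhds (mem_extChartAt_source x)]
    with z hz
  simp only [comp_def]
  rw [(extChartAt (𝓡 m) x).left_inv hz]

theorem contMDiff_normSqDifferential (g : SmoothMetric m M) (h : SmoothMetric n N) {ψ : M → N}
    (hψ : ContMDiff (𝓡 m) (𝓡 n) ∞ ψ) :
    ContMDiff (𝓡 m) 𝓘(ℝ, ℝ) ∞ fun x => normSqDifferential g h ψ x :=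
  (isJointlySmooth_normSqDifferential g h (Φ := fun _ => ψ) isOpen_univ
    (hψ.comp contMDiff_snd).contMDiffOn).contMDiff (mem_univ (0 : ℝ))

/-- The dilation is not assumed to be even continuous, but its square is `|dφ|²/n`. -/
theorem IsHorizontallyConformal.contMDiff_dilation_sq {g : SmoothMetric m M}
    {h : SmoothMetric n N} {φ : M → N} {lam : M → ℝ} (hφ : IsHorizontallyConformal g h φ lam)
    (hn : 1 ≤ n) : ContMDiff (𝓡 m) 𝓘(ℝ, ℝ) ∞ fun x => lam x ^ 2 := by
  have hn0 : (n : ℝ) ≠ 0 := by positivity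
  have h1 : (fun x => lam x ^ 2) = fun x => (n : ℝ)⁻¹ * normSqDifferential g h φ x := by
    funext x
    rw [normSqDifferential_eq_trace, hφ.trace_framePullback, inv_mul_cancel_left₀ hn0]
  rw [h1]
  exact contMDiff_const.mul (contMDiff_normSqDifferential g h hφ.smooth)

theorem contMDiff_rpow_const {u : M → ℝ} (hu : ContMDiff (𝓡 m) 𝓘(ℝ, ℝ) ∞ u)
    (hpos : ∀ x, 0 < u x) (a : ℝ) : ContMDiff (𝓡 m) 𝓘(ℝ, ℝ) ∞ fun x => u x ^ a := fun x =>
  ((Real.contDiffAt_rpow_const_of_ne (hpos x).ne').contMDiffAt (n := ∞)).comp x (hu x)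

variable [T2Space M] [SigmaCompactSpace M] [MeasurableSpace M] [BorelSpace M]

/-- If the first variation of `E` at `φ` is a nonzero multiple of the first variation of the
Dirichlet energy density weighted by `u`, and `g' = u^(2/(m-2)) g`, then `φ` is critical for `E`
if and only if it is harmonic with respect to `g'`. -/
theorem isCriticalPoint_iff_isHarmonicMap (hm : m ≠ 2) {g g' : SmoothMetric m M}
    {h : SmoothMetric n N} {φ : M → N} {u : M → ℝ} (hu : ContMDiff (𝓡 m) 𝓘(ℝ, ℝ) ∞ u)
    (hpos : ∀ x, 0 < u x) (hg : IsConformalChange (fun x => u x ^ ((2 : ℝ) / ((m : ℝ) - 2))) g g')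
    {E : (M → N) → Set M → ℝ} {c : ℝ} (hc : c ≠ 0)
    (hE : ∀ (D : Set M) (ε : ℝ) (Φ : ℝ → M → N), IsCompact D → 0 < ε →
      ContMDiffOn (𝓘(ℝ, ℝ).prod (𝓡 m)) (𝓡 n) ∞ (uncurry Φ) (Ioo (-ε) ε ×ˢ univ) → Φ 0 = φ →
      HasDerivAt (fun t => E (Φ t) D) (c * (1 / 2 * ∫ x in D, u x *
        deriv (fun t => normSqDifferential g h (Φ t) x) 0 ∂(riemannianMeasure g))) 0) :
    IsCriticalPoint m n E φ ↔ IsHarmonicMap g' h φ := by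
  have hm' : (m : ℝ) - 2 ≠ 0 := sub_ne_zero.mpr (by exact_mod_cast hm)
  have hharm : ∀ (D : Set M) (ε : ℝ) (Φ : ℝ → M → N), IsCompact D → 0 < ε →
      ContMDiffOn (𝓘(ℝ, ℝ).prod (𝓡 m)) (𝓡 n) ∞ (uncurry Φ) (Ioo (-ε) ε ×ˢ univ) →
      HasDerivAt (fun t => sigma1Energy g' h (Φ t) D) (1 / 2 * ∫ x in D, u x *
        deriv (fun t => normSqDifferential g h (Φ t) x) 0 ∂(riemannianMeasure g)) 0 := by
    intro D ε Φ hD hε hΦ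
    -- The exponents `2/(m-2)` and `(m-2)/2` cancel; this is where `m ≠ 2` enters.
    have hweight : ∀ x, (u x ^ ((2 : ℝ) / ((m : ℝ) - 2))) ^ (((m : ℝ) - 2) / 2) = u x := by
      intro x
      rw [← Real.rpow_mul (hpos x).le, div_mul_div_cancel₀ hm', div_self two_ne_zero,
        Real.rpow_one]
    have h1 := ((isJointlySmooth_of_contMDiff hu _).mul
      (isJointlySmooth_normSqDifferential g h isOpen_Ioo hΦ)).hasDerivAt_setIntegral hε hD
        (riemannianMeasure_lt_top g hD)
    simp only [deriv_const_mul_field] at h1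
    refine (h1.const_mul (1 / 2)).congr_of_eventuallyEq (Filter.Eventually.of_forall fun t => ?_)
    simp only [sigma1Energy_of_isConformalChange hg
      (contMDiff_rpow_const hu hpos _).continuous h _ hD.measurableSet, hweight]
  -- The comparison is made for each variation separately: by uniqueness of derivatives, one first
  -- variation is `c` times the other.
  refine and_congr_right fun _ => forall_congr' fun D => forall_congr' fun ε =>
    forall_congr' fun Φ => forall_congr' fun hD => forall_congr' fun hε => forall_congr' fun hΦ =>
    forall_congr' fun hΦ0 => forall_congr' fun _ => ?_
  have h1 := hE D ε Φ hD hε hΦ hΦ0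
  have h2 := hharm D ε Φ hD hε hΦ
  constructor
  · intro h3
    have h4 := (mul_eq_zero.mp (h1.unique h3)).resolve_left hc
    rwa [h4] at h2
  · intro h3
    rwa [h2.unique h3, mul_zero] at h1

theorem hasDerivAt_sigma1Energy (g : SmoothMetric m M) (h : SmoothMetric n N) {D : Set M}
    (hD : IsCompact D) {ε : ℝ} (hε : 0 < ε) {Φ : ℝ → M → N}
    (hΦ : ContMDiffOn (𝓘(ℝ, ℝ).prod (𝓡 m)) (𝓡 n) ∞ (uncurry Φ) (Ioo (-ε) ε ×ˢ univ)) :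
    HasDerivAt (fun t => sigma1Energy g h (Φ t) D) (1 / 2 * ∫ x in D,
      deriv (fun t => normSqDifferential g h (Φ t) x) 0 ∂(riemannianMeasure g)) 0 :=
  ((isJointlySmooth_normSqDifferential g h isOpen_Ioo hΦ).hasDerivAt_setIntegral hε hD
    (riemannianMeasure_lt_top g hD)).const_mul _

theorem hasDerivAt_sigma2Energy {g : SmoothMetric m M} {h : SmoothMetric n N} {φ : M → N}
    {lam : M → ℝ} (hφ : IsHorizontallyConformal g h φ lam) {D : Set M}
    (hD : IsCompact D) {ε : ℝ} (hε : 0 < ε) {Φ : ℝ → M → N}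
    (hΦ : ContMDiffOn (𝓘(ℝ, ℝ).prod (𝓡 m)) (𝓡 n) ∞ (uncurry Φ) (Ioo (-ε) ε ×ˢ univ))
    (hΦ0 : Φ 0 = φ) :
    HasDerivAt (fun t => sigma2Energy g h (Φ t) D) (((n : ℝ) - 1) * (1 / 2 * ∫ x in D,
      lam x ^ 2 * deriv (fun t => normSqDifferential g h (Φ t) x) 0 ∂(riemannianMeasure g))) 0 := by
  have h1 := ((isJointlySmooth_normSqWedgeDifferential g h isOpen_Ioo hΦ).hasDerivAt_setIntegral
    hε hD (riemannianMeasure_lt_top g hD)).const_mul (1 / 2)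
  have h0 : (0 : ℝ) ∈ Ioo (-ε) ε := ⟨by linarith, hε⟩
  simp only [fun x => (hasDerivAt_normSqWedgeDifferential hφ isOpen_Ioo hΦ h0 hΦ0 x).deriv,
    mul_assoc, integral_const_mul] at h1
  exact h1.congr_deriv (by ring)

end Criticality
end

theorem mainTheorem5 {m n : ℕ}
    {M : Type*} [TopologicalSpace M] [ChartedSpace (EuclideanSpace ℝ (Fin m)) M]
    [IsManifold (𝓡 m) ∞ M] [T2Space M] [SigmaCompactSpace M] [MeasurableSpace M] [BorelSpace M]
    {N : Type*} [TopologicalSpace N] [ChartedSpace (EuclideanSpace ℝ (Fin n)) N]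
    [IsManifold (𝓡 n) ∞ N]
    (hm : m ≠ 2) (hn : 1 ≤ n) (K : ℝ) (hK : 0 < K)
    (g : SmoothMetric m M) (h : SmoothMetric n N)
    (φ : M → N) (lam : M → ℝ) (hφ : IsHorizontallyConformal g h φ lam) :
    (∃ g' : SmoothMetric m M,
      IsConformalChange
        (fun x => (1 + K * ((n : ℝ) - 1) * lam x ^ 2) ^ ((2 : ℝ) / ((m : ℝ) - 2))) g g' ∧
      (IsSigma12Critical g h K φ ↔ IsHarmonicMap g' h φ)) ∧
    (2 ≤ n →
      ∃ g' : SmoothMetric m M,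
        IsConformalChange (fun x => |lam x| ^ ((4 : ℝ) / ((m : ℝ) - 2))) g g' ∧
        (IsSigma2Critical g h φ ↔ IsHarmonicMap g' h φ)) := by
  have hlam := hφ.contMDiff_dilation_sq hn
  have hn1 : (0 : ℝ) ≤ (n : ℝ) - 1 := sub_nonneg.mpr (by exact_mod_cast hn)
  refine ⟨?_, fun hn2 => ?_⟩
  · have hu : ContMDiff (𝓡 m) 𝓘(ℝ, ℝ) ∞ fun x => 1 + K * ((n : ℝ) - 1) * lam x ^ 2 :=
      contMDiff_const.add (contMDiff_const.mul hlam)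
    have hpos : ∀ x, 0 < 1 + K * ((n : ℝ) - 1) * lam x ^ 2 := fun x => by positivity
    obtain ⟨g', hg'⟩ := exists_isConformalChange g
      (contMDiff_rpow_const hu hpos ((2 : ℝ) / ((m : ℝ) - 2)))
      fun x => Real.rpow_pos_of_pos (hpos x) _
    refine ⟨g', hg', isCriticalPoint_iff_isHarmonicMap hm hu hpos hg' one_ne_zero
      fun D ε Φ hD hε hΦ hΦ0 => ?_⟩
    have h0 : (0 : ℝ) ∈ Ioo (-ε) ε := ⟨by linarith, hε⟩
    have hcont := (isJointlySmooth_normSqDifferential g h isOpen_Ioo hΦ).continuous_deriv h0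
    have hD' := riemannianMeasure_lt_top g hD
    refine ((hasDerivAt_sigma1Energy g h hD hε hΦ).add
      ((hasDerivAt_sigma2Energy hφ hD hε hΦ hΦ0).const_mul K)).congr_deriv ?_
    simp only [add_mul, one_mul, mul_assoc]
    -- Integrability of both terms is needed to split the integral of the weight `1 + K(n-1)λ²`.
    have hint : IntegrableOn (fun x => K * (((n : ℝ) - 1) * (lam x ^ 2 *
        deriv (fun t => normSqDifferential g h (Φ t) x) 0))) D (riemannianMeasure g) :=
      integrableOn_of_continuous hD hD'
        (continuous_const.mul (continuous_const.mul (hlam.continuous.mul hcont)))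
    rw [integral_add (integrableOn_of_continuous hD hD' hcont) hint, integral_const_mul,
      integral_const_mul]
    ring
  · have hpos : ∀ x, 0 < lam x ^ 2 := fun x => by have := hφ.dilation_ne_zero x; positivity
    -- Passing to `λ²` makes the conformal factor a power of a positive smooth function.
    have hexp : (fun x => |lam x| ^ ((4 : ℝ) / ((m : ℝ) - 2))) =
        fun x => (lam x ^ 2) ^ ((2 : ℝ) / ((m : ℝ) - 2)) := by
      funext x
      rw [← sq_abs, ← Real.rpow_natCast, ← Real.rpow_mul (abs_nonneg _)]
      congr 1
      push_cast
      ring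
    obtain ⟨g', hg'⟩ := exists_isConformalChange g
      (contMDiff_rpow_const hlam hpos ((2 : ℝ) / ((m : ℝ) - 2)))
      fun x => Real.rpow_pos_of_pos (hpos x) _
    -- The constant relating the two first variations is `n - 1`, whence the condition `2 ≤ n`.
    have hn3 : (n : ℝ) - 1 ≠ 0 := by
      have : (2 : ℝ) ≤ n := by exact_mod_cast hn2
      linarith
    rw [hexp]
    exact ⟨g', hg', isCriticalPoint_iff_isHarmonicMap hm hlam hpos hg' hn3
      fun D ε Φ hD hε hΦ hΦ0 => hasDerivAt_sigma2Energy hφ hD hε hΦ hΦ0⟩
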